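/- **Setting.** Literals are propositional variables $x$ or their negations $\bar x$; a clause is a finite set of literals and a CNF a finite set of clauses. An S-form DQBF $\forall U\,\exists E\,\psi$ has finite disjoint sets $U$, $E$ of universal and existential variables, a dependency set $D_x\subseteq U$ for each $x\in E$, and a CNF $\psi$ all of whose variables lie in $U\cup E$; put $D_w=\{w\}$ for $w\in U$. Its size is its number of symbols. Fix any Frege system: a finite, sound and implicationally complete set of schematic rules for formulas over $0,1,\neg,\wedge,\vee,\to,\leftrightarrow$. The proof system dFrege$+\forall$red derives lines (formulas over the currently quantified variables) from $\forall U\,\exists E\,\psi$ by these rules: - Axiom: any clause of $\psi$; - any instance of a rule of the Frege system; - Independent extension: the line $\alpha\to(v\leftrightarrow\bigwedge_{y\in Y}y)$ or $\alpha\to(v\leftrightarrow\bigvee_{y\in Y}y)$, where $\alpha$ is a conjunction of universal literals, $Y$ is a finite set of literals and $v$ is a fresh existential variable, which gets $D_v=\bigl(\bigcup_{y\in Y}D_{\mathrm{var}(y)}\bigr)\setminus\mathrm{var}(\alpha)$; - Reduction: from $L(w)$ derive $L(0)$ or $L(1)$, if $w$ is universal and no existential variable $x$ of $L$ has $w\in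 D_x$; - addition of a fresh universal or existential variable to the quantifiers. For a CNF $\theta$, $\theta\vdash_1\bot$ means that unit propagation on $\theta$ produces the empty clause. For a literal $u$ of a universal variable let $\mathcal S=\{x\in E: \mathrm{var}(u)\in D_x\}$ and $T=\{w\in U: w\ne\mathrm{var}(u),\ w\in D_x\text{ for all }x\in\mathcal S\}$. The outer clause $O_D$ of a clause $D$ consists of the existential literals $k\in D$ with $D_{\mathrm{var}(k)}\subseteq T$ and the universal literals $k\in D$ with $\mathrm{var}(k)\in T$. For a CNF $\psi$ and a clause $K_0\in\psi$, the path literals from $K_0$ form the least set that contains all literals of $K_0$ with variable in $\mathcal S$ and, whenever it contains $p$ and $\bar p\in D\in\psi$, also contains all $q\in D$ with $q\neq\bar p$ and variable in $\mathcal S$. The clauses reachable from $K_0$ are $K_0$ and all $D\in\psi$ with $\bar p\in D$ for some path literal $p$. **Lemma (mixed QRATU/EUR reduction for DQBF).** For every Frege system there is a polynomial $P$ such that the following holds. Let $\forall U\,\exists E\,\psi$ be an S-form DQBF with $\psi=\phi\wedge(C\vee u)$, where $u$ is a literal of a universal variable, and let $\chi_0$ be the set of clauses of $\psi$ reachable from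 $C\vee u$. Suppose that every $D\in\chi_0$ with $\bar u\in D$ satisfies $\phi\wedge\bar C\wedge\bar O_D\vdash_1\bot$. Then with at most $P(\mathrm{size}(\forall U\,\exists E\,\psi))$ rule applications of dFrege$+\forall$red one can extend $\exists E$ to some $\exists E'$ (with $U$ and the dependency sets of the variables in $E$ unchanged) containing for each $x\in\mathcal S$ a new variable $x'$ with $D_{x'}\subseteq D_x$, these variables being pairwise distinct, and derive every clause of $(\phi\wedge C)'$, the copy of $\phi\wedge C$ in which every $x\in\mathcal S$ is replaced by $x'$. -/

import Mathlib

namespace DFrege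

/-! ### Propositional syntax -/

/-- Literals over the countably infinite set `ℕ` of propositional variables. -/
structure Literal where
  var : ℕ
  pos : Bool
deriving DecidableEq

/-- The complementary literal. -/
def Literal.neg (l : Literal) : Literal := ⟨l.var, !l.pos⟩

/-- A clause is a finite set of literals. -/
abbrev Clause := Finset Literal

/-- A formula in conjunctive normal form, as its finite set of clauses. -/
abbrev CNF := Finset Clause

/-- Propositional formulas. -/
inductive Formula where
  | fls : Formula
  | tru : Formula
  | var : ℕ → Formula
  | neg : Formula → Formula
  | and : Formula → Formula → Formula
  | or : Formula → Formula → Formula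
  | imp : Formula → Formula → Formula
  | iff : Formula → Formula → Formula

namespace Formula

/-- The set of variables of a formula. -/
def vars : Formula → Finset ℕ
  | fls => ∅
  | tru => ∅
  | var x => {x}
  | neg a => a.vars
  | and a b => a.vars ∪ b.vars
  | or a b => a.vars ∪ b.vars
  | imp a b => a.vars ∪ b.vars
  | iff a b => a.vars ∪ b.vars

/-- Truth of a formula under a valuation. -/
def Holds (v : ℕ → Prop) : Formula → Prop
  | fls => False
  | tru => True
  | var x => v x
  | neg a => ¬ a.Holds v
  | and a b => a.Holds v ∧ b.Holds v
  | or a b => a.Holds v ∨ b.Holds v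
  | imp a b => a.Holds v → b.Holds v
  | iff a b => (a.Holds v ↔ b.Holds v)

/-- Simultaneous substitution of formulas for variables. -/
def subst (σ : ℕ → Formula) : Formula → Formula
  | fls => fls
  | tru => tru
  | var x => σ x
  | neg a => neg (a.subst σ)
  | and a b => and (a.subst σ) (b.subst σ)
  | or a b => or (a.subst σ) (b.subst σ)
  | imp a b => imp (a.subst σ) (b.subst σ)
  | iff a b => iff (a.subst σ) (b.subst σ)

/-- `L.replace u b` is `L(b)`: every occurrence of the variable `u` in `L` becomes `b`. -/
def replace (L : Formula) (u : ℕ) (b : Formula) : Formula :=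
  L.subst (Function.update var u b)

/-- Finite conjunction; the empty one is `1`. -/
def bigAnd (l : List Formula) : Formula := l.foldr and tru

/-- Finite disjunction; the empty one is `0`. -/
def bigOr (l : List Formula) : Formula := l.foldr or fls

end Formula

/-- A literal as a formula. -/
def Literal.toFormula (l : Literal) : Formula :=
  if l.pos then Formula.var l.var else Formula.neg (Formula.var l.var)

/-- A clause as a formula: the disjunction of its literals, listed in some fixed order. -/
noncomputable def clauseFormula (C : Clause) : Formula :=
  Formula.bigOr (C.toList.map Literal.toFormula)

/-! ### Frege systems -/

/-- A schematic inference rule; an axiom scheme is a rule without premises. -/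
structure FregeRule where
  premises : List Formula
  conclusion : Formula

/-- Derivability from the hypotheses `Γ` by substitution instances of the rules. -/
inductive FregeDerivable (rules : List FregeRule) (Γ : List Formula) : Formula → Prop
  | hyp {A : Formula} : A ∈ Γ → FregeDerivable rules Γ A
  | rule {r : FregeRule} (σ : ℕ → Formula) : r ∈ rules →
      (∀ A ∈ r.premises, FregeDerivable rules Γ (A.subst σ)) →
      FregeDerivable rules Γ (r.conclusion.subst σ)

/-- A Frege system: a finite list of schematic rules that is sound and
(implicationally) complete. -/
structure FregeSystem where
  rules : List FregeRule
  sound : ∀ r ∈ rules, ∀ v : ℕ → Prop,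
    (∀ A ∈ r.premises, A.Holds v) → r.conclusion.Holds v
  complete : ∀ (Γ : List Formula) (B : Formula),
    (∀ v : ℕ → Prop, (∀ A ∈ Γ, A.Holds v) → B.Holds v) → FregeDerivable rules Γ B

/-! ### S-form DQBFs -/

/-- The quantifiers of an S-form DQBF: the universal variables, the existential variables
and their dependency sets (`dep x` is relevant only for existential `x`). -/
structure DepPrefix where
  univ : Finset ℕ
  exis : Finset ℕ
  dep : ℕ → Finset ℕ
  disjoint : Disjoint univ exis
  dep_subset : ∀ x ∈ exis, dep x ⊆ univ

namespace DepPrefix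

/-- All quantified variables. -/
def vars (P : DepPrefix) : Finset ℕ := P.univ ∪ P.exis

/-- The dependency set of a quantified variable, where `D_u = {u}` for universal `u`. -/
def depSet (P : DepPrefix) (x : ℕ) : Finset ℕ := if x ∈ P.exis then P.dep x else {x}

/-- Add the new existential variable `v` with dependency set `D`. -/
def addExists (P : DepPrefix) (v : ℕ) (D : Finset ℕ) (hv : v ∉ P.vars) (hD : D ⊆ P.univ) :
    DepPrefix where
  univ := P.univ
  exis := insert v P.exis
  dep := Function.update P.dep v D
  disjoint := by
    rw [Finset.disjoint_insert_right]
    exact ⟨fun h => hv (Finset.mem_union_left _ h), P.disjoint⟩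
  dep_subset := by
    intro x hx
    by_cases h : x = v
    · subst h
      simpa using hD
    · simpa [Function.update_of_ne h] using P.dep_subset x (Finset.mem_of_mem_insert_of_ne hx h)

/-- Add the new universal variable `v`. -/
def addForall (P : DepPrefix) (v : ℕ) (hv : v ∉ P.vars) : DepPrefix where
  univ := insert v P.univ
  exis := P.exis
  dep := P.dep
  disjoint := by
    rw [Finset.disjoint_insert_left]
    exact ⟨fun h => hv (Finset.mem_union_right _ h), P.disjoint⟩
  dep_subset := fun x hx => (P.dep_subset x hx).trans (Finset.subset_insert _ _)

/-- The dependency set `(⋃_{y ∈ Y} D_y) \ D_α` of an independent extension variable. -/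
def extDep (P : DepPrefix) (α Y : Finset Literal) : Finset ℕ :=
  (Y.biUnion fun y => P.depSet y.var) \ α.image Literal.var

theorem extDep_subset (P : DepPrefix) (α Y : Finset Literal)
    (hY : ∀ y ∈ Y, y.var ∈ P.vars) : P.extDep α Y ⊆ P.univ := by
  refine Finset.sdiff_subset.trans (Finset.biUnion_subset.2 fun y hy => ?_)
  unfold depSet
  split_ifs with h
  · exact P.dep_subset _ h
  · rcases Finset.mem_union.1 (hY y hy) with h' | h'
    · simpa using h'
    · exact absurd h' h

end DepPrefix

/-- A closed S-form DQBF with a CNF matrix. -/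
structure DQBF where
  pre : DepPrefix
  matrix : CNF
  closed : ∀ K ∈ matrix, ∀ l ∈ K, l.var ∈ pre.vars

/-- The size of a DQBF: the number of symbols, counting every variable, every element of a
dependency set, every clause and every occurrence of a literal. -/
def DQBF.size (Q : DQBF) : ℕ :=
  Q.pre.univ.card + ∑ x ∈ Q.pre.exis, (1 + (Q.pre.dep x).card) +
    ∑ K ∈ Q.matrix, (1 + K.card)

/-! ### The proof system dFrege+∀red -/

/-- A stage of a derivation: the current quantifiers and the lines derived so far. -/
structure Stage where
  pre : DepPrefix
  lines : List Formula

/-- The conjunction of a finite set of literals, as a formula. -/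
noncomputable def conjFormula (Y : Finset Literal) : Formula :=
  Formula.bigAnd (Y.toList.map Literal.toFormula)

/-- One rule application of dFrege+∀red, over the Frege system `F` and a matrix with the
set of conjuncts `M`. All lines contain only quantified variables. -/
inductive Step (F : FregeSystem) (M : Set Formula) : Stage → Stage → Prop
  /-- Axiom: a conjunct of the matrix. -/
  | ax (P : DepPrefix) (Γ : List Formula) (L : Formula) :
      L ∈ M → Step F M ⟨P, Γ⟩ ⟨P, L :: Γ⟩
  /-- A substitution instance of a rule of the Frege system. -/
  | frege (P : DepPrefix) (Γ : List Formula) (r : FregeRule) (σ : ℕ → Formula) :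
      r ∈ F.rules → (∀ A ∈ r.premises, A.subst σ ∈ Γ) →
      (r.conclusion.subst σ).vars ⊆ P.vars →
      Step F M ⟨P, Γ⟩ ⟨P, r.conclusion.subst σ :: Γ⟩
  /-- IndExt-∧: the line `α → (v ↔ ⋀ Y)` for a fresh existential variable `v`. -/
  | indExtAnd (P : DepPrefix) (Γ : List Formula) (α Y : Finset Literal) (v : ℕ)
      (hα : ∀ a ∈ α, a.var ∈ P.univ) (hY : ∀ y ∈ Y, y.var ∈ P.vars) (hv : v ∉ P.vars) :
      Step F M ⟨P, Γ⟩
        ⟨P.addExists v (P.extDep α Y) hv (P.extDep_subset α Y hY),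
          Formula.imp (conjFormula α) (Formula.iff (Formula.var v) (conjFormula Y)) :: Γ⟩
  /-- IndExt-∨: the line `α → (v ↔ ⋁ Y)` for a fresh existential variable `v`. -/
  | indExtOr (P : DepPrefix) (Γ : List Formula) (α Y : Finset Literal) (v : ℕ)
      (hα : ∀ a ∈ α, a.var ∈ P.univ) (hY : ∀ y ∈ Y, y.var ∈ P.vars) (hv : v ∉ P.vars) :
      Step F M ⟨P, Γ⟩
        ⟨P.addExists v (P.extDep α Y) hv (P.extDep_subset α Y hY),
          Formula.imp (conjFormula α) (Formula.iff (Formula.var v) (clauseFormula Y)) :: Γ⟩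
  /-- 0-red: from `L(u)` derive `L(0)`. -/
  | red0 (P : DepPrefix) (Γ : List Formula) (L : Formula) (u : ℕ) :
      L ∈ Γ → u ∈ P.univ → (∀ x ∈ L.vars, x ∈ P.exis → u ∉ P.dep x) →
      Step F M ⟨P, Γ⟩ ⟨P, L.replace u Formula.fls :: Γ⟩
  /-- 1-red: from `L(u)` derive `L(1)`. -/
  | red1 (P : DepPrefix) (Γ : List Formula) (L : Formula) (u : ℕ) :
      L ∈ Γ → u ∈ P.univ → (∀ x ∈ L.vars, x ∈ P.exis → u ∉ P.dep x) →
      Step F M ⟨P, Γ⟩ ⟨P, L.replace u Formula.tru :: Γ⟩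
  /-- Weakening of the quantifiers by a new existential variable. -/
  | weakenExists (P : DepPrefix) (Γ : List Formula) (v : ℕ) (D : Finset ℕ)
      (hv : v ∉ P.vars) (hD : D ⊆ P.univ) :
      Step F M ⟨P, Γ⟩ ⟨P.addExists v D hv hD, Γ⟩
  /-- Weakening of the quantifiers by a new universal variable. -/
  | weakenForall (P : DepPrefix) (Γ : List Formula) (v : ℕ) (hv : v ∉ P.vars) :
      Step F M ⟨P, Γ⟩ ⟨P.addForall v hv, Γ⟩

/-- `Derives F Q n s`: the stage `s` is reached from the DQBF `Q` by exactly `n` rule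
applications of dFrege+∀red. -/
inductive Derives (F : FregeSystem) (Q : DQBF) : ℕ → Stage → Prop
  | start : Derives F Q 0 ⟨Q.pre, []⟩
  | step {n : ℕ} {s t : Stage} : Derives F Q n s →
      Step F {L | ∃ K ∈ Q.matrix, L = clauseFormula K} s t → Derives F Q (n + 1) t

/-! ### Unit propagation -/

/-- The literals that unit propagation on `φ` makes true: `l` is propagated when it is
the only literal left in some clause after deleting falsified literals. -/
inductive Propagates (φ : CNF) : Literal → Prop
  | unit {K : Clause} {l : Literal} : K ∈ φ → l ∈ K →
      (∀ k ∈ K, k ≠ l → Propagates φ k.neg) → Propagates φ l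

/-- `φ ⊢₁ ⊥`: unit propagation deletes all the literals of some clause of `φ`. -/
def UnitRefutes (φ : CNF) : Prop :=
  ∃ K ∈ φ, ∀ k ∈ K, Propagates φ k.neg

/-- The negation of a clause, as a conjunction of unit clauses. -/
def negClause (C : Clause) : CNF := C.image fun l => {l.neg}

/-! ### Resolution paths and outer clauses -/

/-- The `S`-literals on the resolution paths in `φ` from `χ`. -/
inductive PathLit (φ χ : CNF) (S : Set ℕ) : Literal → Prop
  | init {K : Clause} {l : Literal} : K ∈ χ → l ∈ K → l.var ∈ S → PathLit φ χ S l
  | step {p q : Literal} {D : Clause} : PathLit φ χ S p → D ∈ φ → p.neg ∈ D →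
      q ∈ D → q ≠ p.neg → q.var ∈ S → PathLit φ χ S q

/-- The clauses on the resolution paths in `φ` from `χ`. -/
def PathClause (φ χ : CNF) (S : Set ℕ) (D : Clause) : Prop :=
  D ∈ χ ∨ (D ∈ φ ∧ ∃ p, PathLit φ χ S p ∧ p.neg ∈ D)

namespace DepPrefix

/-- `𝒮`: the existential variables that depend on the universal variable `u`. -/
def dependents (P : DepPrefix) (u : ℕ) : Finset ℕ := {x ∈ P.exis | u ∈ P.dep x}

/-- `T`: the universal variables other than `u` on which all variables in `𝒮` depend. -/
def commonDeps (P : DepPrefix) (u : ℕ) : Finset ℕ :=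
  {w ∈ P.univ | w ≠ u ∧ ∀ x ∈ P.dependents u, w ∈ P.dep x}

/-- The outer clause `O_D` of `D` with respect to the universal variable `u`. -/
def outerClause (P : DepPrefix) (u : ℕ) (D : Clause) : Clause :=
  {k ∈ D | (k.var ∈ P.exis ∧ P.dep k.var ⊆ P.commonDeps u) ∨
    (k.var ∈ P.univ ∧ k.var ∈ P.commonDeps u)}

end DepPrefix

/-- The copy of a clause in which every variable `x` is replaced by `ρ x`. -/
def renameClause (ρ : ℕ → ℕ) (K : Clause) : Clause := K.image fun l => ⟨ρ l.var, l.pos⟩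

end DFrege

/-! Each `x ∈ 𝒮` gets a copy `x₀` through the independent extension `ū → (x₀ ↔ x)`, so that `x₀`
does not depend on `var(u)`. Every matrix clause `K` then yields `u ∨ K[x := x₀]`, in which no
existential variable depends on `var(u)`. Reduction sets `u` to false and leaves `K` restricted to
`ū` over the copies: a second model of the matrix, independent of `var(u)`.

Unit propagation gives `C ∨ O_D` for each reachable `D` containing `ū`. The switch is `s = u ∧ ⋀
O_D`. If `s` is false, `x'` is `x`. If `s` is true, `x'` mixes `x` and `x₀` according to which of
the literals `x`, `x̄` are path literals: `x₀` if both are, `x ∨ x₀` if only `x` is, `x ∧ x₀` if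
only `x̄` is, and `x` if neither is. Each `O_D` depends only on `T`, which lies in every `D_x`, so
`x'` depends on nothing outside `D_x`.

With the switch off, the old clauses hold for `x'`; moreover `C` holds, since otherwise all the
`O_D` and `u` would be true and the switch on. With the switch on, a path literal true at `x₀` stays
true at `x'`, a literal whose complement is not on a path keeps its truth from `x`, and a literal
true at both is true at `x'`. A clause without complements of path literals is therefore inherited
from `x`. A clause that a path enters either contains `ū`, and then its outer clause is true, or
contains `u`, or else is inherited from its restriction to `x₀`, helped by its original when the
entry literal is not itself on a path. The restriction of `C ∨ u` gives `C`, whose `𝒮`-literals all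
start paths.

The propositional work is done in an auxiliary calculus whose inferences are sound schemata of
bounded weight (`Prov`). There are finitely many of these, so any Frege system simulates each in a
constant number of steps (`exists_simulates`). The case analysis is `CopySetup.rename`;
`exists_copySetup` supplies its hypotheses. -/

namespace DFrege

/-! ### Weights of schemata and substitution -/

namespace Formula

/-- The number of nodes of a formula, where a variable counts with its index. -/
def weight : Formula → ℕ
  | fls => 1
  | tru => 1
  | var x => x + 1
  | neg a => a.weight + 1
  | and a b => a.weight + b.weight + 1
  | or a b => a.weight + b.weight + 1
  | imp a b => a.weight + b.weight + 1
  | iff a b => a.weight + b.weight + 1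

theorem weight_pos (A : Formula) : 0 < A.weight := by
  cases A <;> simp [weight]

/-- Charging a variable its index leaves only finitely many variables, hence finitely many schemata,
below a given weight. The uniform simulation constant rests on this. -/
theorem finite_weight_le (n : ℕ) : {A : Formula | A.weight ≤ n}.Finite := by
  induction n with
  | zero =>
    convert Set.finite_empty
    ext A
    simpa using (weight_pos A).ne'
  | succ n ih =>
    refine ((((((((Set.finite_singleton fls).union (Set.finite_singleton tru)).union
      ((Set.finite_Iic n).image var)).union (ih.image neg)).union (ih.image2 and ih)).union
      (ih.image2 or ih)).union (ih.image2 imp ih)).union (ih.image2 iff ih)).subset ?_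
    intro A hA
    cases A <;> simp [weight] at hA ⊢ <;> omega

theorem subst_subst (σ τ : ℕ → Formula) (A : Formula) :
    (A.subst σ).subst τ = A.subst fun i => (σ i).subst τ := by
  induction A <;> simp_all [subst]

theorem subst_congr {σ τ : ℕ → Formula} {A : Formula} (h : ∀ x ∈ A.vars, σ x = τ x) :
    A.subst σ = A.subst τ := by
  induction A <;> simp_all [subst, vars]

theorem subst_var (A : Formula) : A.subst var = A := by
  induction A <;> simp_all [subst]

theorem vars_subst_subset {σ : ℕ → Formula} {V : Finset ℕ} {A : Formula}
    (h : ∀ x ∈ A.vars, (σ x).vars ⊆ V) : (A.subst σ).vars ⊆ V := by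
  induction A <;> simp_all [subst, vars, Finset.union_subset_iff]

end Formula

/-! ### An auxiliary proof calculus with small sound inferences -/

/-- Semantic consequence. -/
def Entails (G : List Formula) (B : Formula) : Prop :=
  ∀ v : ℕ → Prop, (∀ A ∈ G, A.Holds v) → B.Holds v

/-- `L` is an instance of a sound schematic rule of bounded weight with premises in `Γ`. -/
def Infers (Γ : Set Formula) (L : Formula) : Prop :=
  ∃ (G : List Formula) (B : Formula) (σ : ℕ → Formula),
    (G.length ≤ 4 ∧ (∀ A ∈ G, A.weight ≤ 100) ∧ B.weight ≤ 100) ∧ Entails G B ∧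
      (∀ A ∈ G, A.subst σ ∈ Γ) ∧ L = B.subst σ

theorem Infers.mono {Γ Γ' : Set Formula} {L : Formula} (h : Infers Γ L) (hΓ : Γ ⊆ Γ') :
    Infers Γ' L := by
  obtain ⟨G, B, σ, h1, h2, h3, h4⟩ := h
  exact ⟨G, B, σ, h1, h2, fun A hA => hΓ (h3 A hA), h4⟩

/-- Proofs, listed from the last line to the first, by small sound inferences. -/
inductive Derivation (Γ : Set Formula) : List Formula → Prop
  | nil : Derivation Γ []
  | cons {L : Formula} {l : List Formula} : Derivation Γ l → Infers (Γ ∪ {A | A ∈ l}) L →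
      Derivation Γ (L :: l)

theorem Derivation.append {Γ Δ : Set Formula} {l l' : List Formula} (hl : Derivation Γ l)
    (hΔ : Δ ⊆ Γ ∪ {A | A ∈ l}) (hl' : Derivation Δ l') : Derivation Γ (l' ++ l) := by
  induction hl' with
  | nil => exact hl
  | cons _ h ih =>
    refine .cons ih (h.mono (Set.union_subset (hΔ.trans ?_) ?_))
    · rintro A (hA | hA)
      · exact .inl hA
      · exact .inr (List.mem_append_right _ hA)
    · exact fun A hA => .inr (List.mem_append_left _ hA)

/-- All formulas in `Δ` follow from `Γ` by one proof with at most `n` small inferences. -/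
def Prov (Γ : Set Formula) (n : ℕ) (Δ : Set Formula) : Prop :=
  ∃ l, Derivation Γ l ∧ l.length ≤ n ∧ Δ ⊆ Γ ∪ {A | A ∈ l}

namespace Prov

variable {Γ Δ Θ : Set Formula} {n m k : ℕ} {A B X Y Z : Formula}

theorem of_subset (h : Δ ⊆ Γ) : Prov Γ n Δ :=
  ⟨[], .nil, Nat.zero_le _, h.trans Set.subset_union_left⟩

theorem hyp (h : A ∈ Γ) : Prov Γ n {A} := of_subset (by simpa using h)

theorem le (h : Prov Γ n Δ) (hn : n ≤ m) : Prov Γ m Δ := by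
  obtain ⟨l, h1, h2, h3⟩ := h
  exact ⟨l, h1, h2.trans hn, h3⟩

theorem subset (h : Prov Γ n Δ) (hΔ : Θ ⊆ Δ) : Prov Γ n Θ := by
  obtain ⟨l, h1, h2, h3⟩ := h
  exact ⟨l, h1, h2, hΔ.trans h3⟩

theorem cut (h : Prov Γ n Δ) (h' : Prov (Γ ∪ Δ) m Θ) : Prov Γ (n + m) Θ := by
  obtain ⟨l, h1, h2, h3⟩ := h
  obtain ⟨l', h1', h2', h3'⟩ := h'
  have h4 : Γ ∪ Δ ⊆ Γ ∪ {A | A ∈ l} := Set.union_subset Set.subset_union_left h3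
  refine ⟨l' ++ l, h1.append h4 h1', by simp; omega, h3'.trans ?_⟩
  rintro A (hA | hA)
  · rcases h4 hA with h | h
    · exact .inl h
    · exact .inr (List.mem_append_right _ h)
  · exact .inr (List.mem_append_left _ hA)

theorem mono (h : Prov Γ n Δ) (hΓ : Γ ⊆ Θ) : Prov Θ n Δ := by
  obtain ⟨l, h1, h2, h3⟩ := h
  refine ⟨l, by simpa using Derivation.nil.append (hΓ.trans Set.subset_union_left) h1, h2, ?_⟩
  exact h3.trans (Set.union_subset_union_left _ hΓ)

theorem union (h : Prov Γ n Δ) (h' : Prov Γ m Θ) : Prov Γ (n + m) (Δ ∪ Θ) := by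
  refine h.cut ?_
  obtain ⟨l, h1, h2, h3⟩ := h'.mono (Set.subset_union_left (t := Δ))
  exact ⟨l, h1, h2, Set.union_subset (fun A hA => .inl (.inr hA)) h3⟩

theorem infer (h : Prov Γ n Δ) (hB : Infers Δ B) : Prov Γ (n + 1) {B} := by
  refine h.cut ⟨[B], .cons .nil (hB.mono ?_), le_rfl, by simp⟩
  exact fun A hA => .inl (.inr hA)

theorem biUnion {ι : Type*} (s : Finset ι) (Δ : ι → Set Formula)
    (h : ∀ i ∈ s, Prov Γ n (Δ i)) : Prov Γ (s.card * n) (⋃ i ∈ s, Δ i) := by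
  classical
  induction s using Finset.induction_on with
  | empty => exact of_subset (by simp)
  | insert a s ha ih =>
    rw [Finset.card_insert_of_notMem ha, Finset.set_biUnion_insert]
    refine ((h a (by simp)).union (ih fun i hi => h i (by simp [hi]))).le ?_
    ring_nf; rfl

/-- Instances of a schematic rule without premises. -/
theorem rule0 (l : List Formula) (B : Formula) (hB : Entails [] B)
    (hs : B.weight ≤ 100 := by decide) :
    Prov Γ 1 {B.subst fun i => l.getD i .tru} :=
  (of_subset (n := 0) (Set.empty_subset Γ)).infer
    ⟨[], B, _, ⟨by simp, by simp, hs⟩, hB, by simp, rfl⟩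

/-- Instances of a schematic rule with one premise. -/
theorem rule1 (l : List Formula) (A B : Formula)
    (h : Prov Γ n {A.subst fun i => l.getD i .tru}) (hB : Entails [A] B)
    (hs : A.weight ≤ 100 ∧ B.weight ≤ 100 := by decide) :
    Prov Γ (n + 1) {B.subst fun i => l.getD i .tru} :=
  h.infer ⟨[A], B, _, ⟨by simp, by simpa using hs.1, hs.2⟩, hB, by simp, rfl⟩

/-- Instances of a schematic rule with two premises. -/
theorem rule2 (l : List Formula) (A A' B : Formula)
    (h : Prov Γ n {A.subst fun i => l.getD i .tru})
    (h' : Prov Γ m {A'.subst fun i => l.getD i .tru}) (hB : Entails [A, A'] B)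
    (hs : A.weight ≤ 100 ∧ A'.weight ≤ 100 ∧ B.weight ≤ 100 := by decide) :
    Prov Γ (n + m + 1) {B.subst fun i => l.getD i .tru} :=
  (h.union h').infer
    ⟨[A, A'], B, _, ⟨by simp, by simpa using ⟨hs.1, hs.2.1⟩, hs.2.2⟩, hB, by simp, rfl⟩

/-- Instances of a schematic rule with three premises. -/
theorem rule3 (l : List Formula) (A A' A'' B : Formula)
    (h : Prov Γ n {A.subst fun i => l.getD i .tru})
    (h' : Prov Γ m {A'.subst fun i => l.getD i .tru})
    (h'' : Prov Γ k {A''.subst fun i => l.getD i .tru}) (hB : Entails [A, A', A''] B)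
    (hs : A.weight ≤ 100 ∧ A'.weight ≤ 100 ∧ A''.weight ≤ 100 ∧ B.weight ≤ 100 := by decide) :
    Prov Γ (n + m + k + 1) {B.subst fun i => l.getD i .tru} :=
  ((h.union h').union h'').infer
    ⟨[A, A', A''], B, _, ⟨by simp, by simpa using ⟨hs.1, hs.2.1, hs.2.2.1⟩, hs.2.2.2⟩, hB,
      by simp, rfl⟩

open Formula

theorem mp (h : Prov Γ n {imp A B}) (h' : Prov Γ m {A}) : Prov Γ (n + m + 1) {B} :=
  rule2 [A, B] (imp (var 0) (var 1)) (var 0) (var 1) h h' (by simp +contextual [Entails, Holds])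

theorem bigOr_imp {l : List Formula} (h : ∀ A ∈ l, Prov Γ n {imp A B}) :
    Prov Γ (l.length * (n + 1) + 1) {imp (bigOr l) B} := by
  induction l with
  | nil =>
    exact (rule0 [B] (imp fls (var 0)) (by simp [Entails, Holds])).le (by simp)
  | cons a l ih =>
    refine (rule2 [a, B, bigOr l] (imp (var 0) (var 1)) (imp (var 2) (var 1))
      (imp (or (var 0) (var 2)) (var 1)) (h a (by simp)) (ih fun A hA => h A (by simp [hA])) ?_).le
      ?_
    · intro v; simp [Holds]; tauto
    · simp only [List.length_cons]; ring_nf; rfl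

theorem imp_bigOr {l : List Formula} (h : A ∈ l) : Prov Γ l.length {imp A (bigOr l)} := by
  induction l with
  | nil => simp at h
  | cons a l ih =>
    rcases List.mem_cons.1 h with rfl | h
    · refine (rule0 [A, bigOr l] (imp (var 0) (or (var 0) (var 1))) ?_).le (by simp)
      intro v; simp [Holds]; tauto
    · refine rule1 [A, bigOr l, a] (imp (var 0) (var 1)) (imp (var 0) (or (var 2) (var 1)))
        (ih h) ?_
      intro v; simp [Holds]; tauto

theorem imp_bigAnd {l : List Formula} (h : ∀ A ∈ l, Prov Γ n {imp B A}) :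
    Prov Γ (l.length * (n + 1) + 1) {imp B (bigAnd l)} := by
  induction l with
  | nil => exact (rule0 [B] (imp (var 0) tru) (by simp [Entails, Holds])).le (by simp)
  | cons a l ih =>
    refine (rule2 [a, B, bigAnd l] (imp (var 1) (var 0)) (imp (var 1) (var 2))
      (imp (var 1) (and (var 0) (var 2))) (h a (by simp)) (ih fun A hA => h A (by simp [hA]))
      ?_).le ?_
    · intro v; simp [Holds]; tauto
    · simp only [List.length_cons]; ring_nf; rfl

theorem bigAnd_imp {l : List Formula} (h : A ∈ l) : Prov Γ l.length {imp (bigAnd l) A} := by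
  induction l with
  | nil => simp at h
  | cons a l ih =>
    rcases List.mem_cons.1 h with rfl | h
    · refine (rule0 [A, bigAnd l] (imp (and (var 0) (var 1)) (var 0)) ?_).le (by simp)
      intro v; simp [Holds]; tauto
    · refine rule1 [A, bigAnd l, a] (imp (var 1) (var 0)) (imp (and (var 2) (var 1)) (var 0))
        (ih h) ?_
      intro v; simp [Holds]; tauto

theorem clauseFormula_imp {K : Clause} (h : ∀ l ∈ K, Prov Γ n {imp l.toFormula B}) :
    Prov Γ (K.card * (n + 1) + 1) {imp (clauseFormula K) B} := by
  have := bigOr_imp (Γ := Γ) (n := n) (B := B) (l := K.toList.map Literal.toFormula)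
    (by simpa using h)
  simpa [clauseFormula] using this

theorem imp_clauseFormula {K : Clause} {l : Literal} (h : l ∈ K) :
    Prov Γ K.card {imp l.toFormula (clauseFormula K)} := by
  have := imp_bigOr (Γ := Γ) (l := K.toList.map Literal.toFormula) (A := l.toFormula)
    (List.mem_map_of_mem (by simpa using h))
  simpa [clauseFormula] using this

/-! ### Unit propagation as short proofs -/

theorem of_clause {K : Clause} (hK : Prov Γ n {imp A (clauseFormula K)})
    (h : ∀ l ∈ K, Prov Γ m {imp l.toFormula (imp A B)}) :
    Prov Γ (n + (K.card * (m + 1) + 1) + 1) {imp A B} :=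
  rule2 [A, B, clauseFormula K] (imp (var 0) (var 2)) (imp (var 2) (imp (var 0) (var 1)))
    (imp (var 0) (var 1)) hK (clauseFormula_imp h) (by intro v; simp [Holds]; tauto)

theorem of_neg_literal {l : Literal} (h : Prov Γ n {imp A l.neg.toFormula}) :
    Prov Γ (n + 1) {imp l.toFormula (imp A B)} := by
  obtain ⟨x, b⟩ := l
  cases b
  · exact rule1 [A, B, var x] (imp (var 0) (var 2)) (imp (neg (var 2)) (imp (var 0) (var 1))) h
      (by intro v; simp [Holds]; tauto)
  · exact rule1 [A, B, var x] (imp (var 0) (neg (var 2))) (imp (var 2) (imp (var 0) (var 1))) h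
      (by intro v; simp [Holds]; tauto)

/-- One unit propagation step under the assumption `A`: case analysis on `K`, where every literal is
either the target or already refuted. With `B = fls` the same step closes a refutation. -/
theorem of_unit {K : Clause} (hK : Prov Γ n {imp A (clauseFormula K)})
    (h : ∀ l ∈ K, l.toFormula = B ∨ imp A l.neg.toFormula ∈ Γ) :
    Prov Γ (n + 2 * K.card + 2) {imp A B} := by
  refine (of_clause (m := 1) hK fun l hl => ?_).le (by ring_nf; rfl)
  rcases h l hl with rfl | h
  · exact rule0 [A, l.toFormula] (imp (var 1) (imp (var 0) (var 1)))
      (by intro v; simp [Holds]; tauto)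
  · exact of_neg_literal (hyp (n := 0) h)

-- Induction on the number `j` of propagated literals not yet collected in `Y`. Each is proved once
-- and shared by later steps, so the cost is linear in `j`; unfolding the inductive predicate as a
-- tree could be exponential.
open Classical in
theorem propagate {θ : CNF} (hθ : ∀ K ∈ θ, Prov Γ n {imp A (clauseFormula K)})
    (hm : ∀ K ∈ θ, K.card ≤ m) (j : ℕ) :
    ∀ Y ⊆ {l ∈ θ.biUnion id | Propagates θ l},
      ({l ∈ θ.biUnion id | Propagates θ l} \ Y).card = j →
      Prov (Γ ∪ (fun l : Literal => imp A l.toFormula) '' Y) (j * (n + 2 * m + 2))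
        ((fun l : Literal => imp A l.toFormula) '' {l | Propagates θ l}) := by
  induction j with
  | zero =>
    intro Y hY hj
    refine of_subset (Set.subset_union_of_subset_right (Set.image_mono ?_) _)
    intro l hl
    have h : l ∈ θ.biUnion id := by
      cases hl with
      | unit hK hl _ => exact Finset.mem_biUnion.2 ⟨_, hK, hl⟩
    by_contra hlY
    have : l ∈ {l ∈ θ.biUnion id | Propagates θ l} \ Y :=
      Finset.mem_sdiff.2 ⟨Finset.mem_filter.2 ⟨h, hl⟩, hlY⟩
    rw [Finset.card_eq_zero.1 hj] at this
    simp at this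
  | succ j ih =>
    intro Y hY hj
    obtain ⟨K, hK, l, hl, hlY, hlK⟩ :
        ∃ K ∈ θ, ∃ l ∈ K, l ∉ Y ∧ ∀ k ∈ K, k ≠ l → k.neg ∈ Y := by
      -- Otherwise `Y` is closed under propagation and contains every propagated literal, although
      -- `j + 1` of them are missing.
      by_contra! hcon
      obtain ⟨l, hl⟩ := Finset.card_pos.1 ((Nat.succ_pos j).trans_eq hj.symm)
      obtain ⟨hl1, hl2⟩ := Finset.mem_sdiff.1 hl
      have h2 : Propagates θ l := (Finset.mem_filter.1 hl1).2
      apply hl2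
      clear hl1 hl2 hl
      induction h2 with
      | unit hK hl _ ih' =>
        by_contra hlY
        obtain ⟨k, hk, hkl, hkY⟩ := hcon _ hK _ hl hlY
        exact hkY (ih' k hk hkl)
    have hmem : l ∈ {l ∈ θ.biUnion id | Propagates θ l} :=
      Finset.mem_filter.2 ⟨Finset.mem_biUnion.2 ⟨K, hK, hl⟩,
        .unit hK hl fun k hk hkl => (Finset.mem_filter.1 (hY (hlK k hk hkl))).2⟩
    have h1 : Prov (Γ ∪ (fun l : Literal => imp A l.toFormula) '' Y) (n + 2 * m + 2)
        {imp A l.toFormula} := by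
      refine (of_unit (K := K) ((hθ K hK).mono Set.subset_union_left) fun k hk => ?_).le
        (by have := hm K hK; omega)
      by_cases hkl : k = l
      · exact .inl (by rw [hkl])
      · exact .inr (.inr ⟨k.neg, hlK k hk hkl, rfl⟩)
    have h2 := ih (insert l Y) (Finset.insert_subset hmem hY) (by
      rw [Finset.sdiff_insert, Finset.card_erase_of_mem (Finset.mem_sdiff.2 ⟨hmem, hlY⟩), hj]
      rfl)
    refine (h1.cut (h2.mono ?_)).le (by ring_nf; rfl)
    rw [Finset.coe_insert, Set.image_insert_eq]
    rintro B (hB | rfl | hB)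
    · exact .inl (.inl hB)
    · exact .inr rfl
    · exact .inl (.inr hB)

theorem unitRefutes {θ : CNF} (hθ : ∀ K ∈ θ, Prov Γ n {imp A (clauseFormula K)})
    (hm : ∀ K ∈ θ, K.card ≤ m) (h : UnitRefutes θ) :
    Prov Γ ((θ.card * m + 1) * (n + 2 * m + 2)) {imp A fls} := by
  classical
  have h1 := propagate hθ hm _ ∅ (by simp) rfl
  obtain ⟨K, hK, hKp⟩ := h
  have h2 : Prov (Γ ∪ (fun l : Literal => imp A l.toFormula) '' {l | Propagates θ l})
      (n + 2 * m + 2) {imp A fls} := by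
    refine (of_unit (K := K) ((hθ K hK).mono Set.subset_union_left) fun k hk => ?_).le
      (by have := hm K hK; omega)
    exact .inr (.inr ⟨k.neg, hKp k hk, rfl⟩)
  refine ((h1.mono (by simp)).cut h2).le ?_
  rw [add_mul, one_mul]
  -- At most `θ.card * m` literals occur in `θ`; the extra `1` in the bound pays for refuting the
  -- conflict clause.
  refine Nat.add_le_add_right (Nat.mul_le_mul_right _ ?_) _
  refine (Finset.card_le_card (Finset.sdiff_subset.trans (Finset.filter_subset _ _))).trans ?_
  exact Finset.card_biUnion_le_card_mul _ _ _ hm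

theorem neg_literal_clause {l : Literal} (h : Prov Γ n {imp l.toFormula B})
    (hB : Prov Γ k {imp A (neg B)}) : Prov Γ (n + k + 1) {imp A (clauseFormula {l.neg})} := by
  have hc : clauseFormula {l.neg} = or l.neg.toFormula fls := by simp [clauseFormula, bigOr]
  rw [hc]
  obtain ⟨x, b⟩ := l
  cases b
  · exact rule2 [A, B, var x] (imp (neg (var 2)) (var 1)) (imp (var 0) (neg (var 1)))
      (imp (var 0) (or (var 2) fls)) h hB (by intro v; simp [Holds]; tauto)
  · exact rule2 [A, B, var x] (imp (var 2) (var 1)) (imp (var 0) (neg (var 1)))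
      (imp (var 0) (or (neg (var 2)) fls)) h hB (by intro v; simp [Holds]; tauto)

/-- Clauses refuted by unit propagation have short proofs. -/
theorem or_of_unitRefutes {φ : CNF} {C O : Clause} (hφ : ∀ K ∈ φ, clauseFormula K ∈ Γ)
    (hm : ∀ K ∈ φ, K.card ≤ m) (hφm : φ.card ≤ m) (hC : C.card ≤ m) (hO : O.card ≤ m)
    (h : UnitRefutes (φ ∪ negClause C ∪ negClause O)) :
    Prov Γ (20 * (m + 1) ^ 3) {or (clauseFormula C) (clauseFormula O)} := by
  -- The negation of the goal is carried as the assumption `A`. The width is `m + 1` rather than `m`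
  -- because the added unit clauses have one literal even when `m = 0`.
  have h1 := unitRefutes (Γ := Γ) (n := m + 2) (m := m + 1)
    (A := neg (or (clauseFormula C) (clauseFormula O))) (θ := φ ∪ negClause C ∪ negClause O)
    ?_ ?_ h
  · refine (rule1 [clauseFormula C, clauseFormula O] (imp (neg (or (var 0) (var 1))) fls)
      (or (var 0) (var 1)) h1 (by intro v; simp [Holds]; tauto)).le ?_
    have hc : (φ ∪ negClause C ∪ negClause O).card ≤ 3 * m := by
      refine (Finset.card_union_le _ _).trans ?_
      have := Finset.card_union_le φ (negClause C)
      have h2 : (negClause C).card ≤ C.card := Finset.card_image_le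
      have h3 : (negClause O).card ≤ O.card := Finset.card_image_le
      omega
    calc _ ≤ (3 * m * (m + 1) + 1) * (m + 2 + 2 * (m + 1) + 2) + 1 := by gcongr
      _ ≤ _ := by ring_nf; nlinarith [Nat.zero_le m]
  · intro K hK
    simp only [Finset.mem_union, negClause, Finset.mem_image] at hK
    rcases hK with (hK | ⟨l, hl, rfl⟩) | ⟨l, hl, rfl⟩
    · refine (rule1 [clauseFormula K, neg (or (clauseFormula C) (clauseFormula O))] (var 0)
        (imp (var 1) (var 0)) (hyp (n := 0) (hφ K hK)) (by intro v; simp [Holds]; tauto)).le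
        (by omega)
    · refine (neg_literal_clause (imp_clauseFormula hl) (rule0 [clauseFormula C, clauseFormula O]
        (imp (neg (or (var 0) (var 1))) (neg (var 0))) (by intro v; simp [Holds]; tauto))).le
        (by omega)
    · refine (neg_literal_clause (imp_clauseFormula hl) (rule0 [clauseFormula C, clauseFormula O]
        (imp (neg (or (var 0) (var 1))) (neg (var 1))) (by intro v; simp [Holds]))).le
        (by omega)
  · intro K hK
    simp only [Finset.mem_union, negClause, Finset.mem_image] at hK
    rcases hK with (hK | ⟨l, hl, rfl⟩) | ⟨l, hl, rfl⟩
    · exact (hm K hK).trans (Nat.le_succ m)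
    · simp
    · simp

end Prov

/-! ### The switch formula and its effect on literals -/

namespace Formula

/-- The constant with the truth value `b`. -/
def ofBool (b : Bool) : Formula := if b then tru else fls

/-- The formula `A` or its negation. -/
def signed (b : Bool) (A : Formula) : Formula := if b then A else neg A

/-- If `s` is false, the value of `x`. If `s` is true, the value of `x₀`, combined
disjunctively with `x` unless `q` and conjunctively with `x` unless `p`. -/
def switch (s x x₀ : Formula) (p q : Bool) : Formula :=
  or (and s (and x₀ (ofBool p))) (and x (or (neg s) (or x₀ (neg (ofBool q)))))

theorem subst_bigOr (σ : ℕ → Formula) (l : List Formula) :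
    (bigOr l).subst σ = bigOr (l.map (subst σ)) := by
  induction l with
  | nil => rfl
  | cons a l ih => simpa [bigOr, subst] using ih

end Formula

open Formula

theorem Literal.toFormula_eq_signed (l : Literal) :
    l.toFormula = signed l.pos (Formula.var l.var) := rfl

theorem Literal.subst_toFormula (l : Literal) (σ : ℕ → Formula) :
    l.toFormula.subst σ = signed l.pos (σ l.var) := by
  obtain ⟨x, b⟩ := l
  cases b <;> rfl

theorem subst_clauseFormula (K : Clause) (σ : ℕ → Formula) :
    (clauseFormula K).subst σ = bigOr (K.toList.map fun l => signed l.pos (σ l.var)) := by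
  simp [clauseFormula, subst_bigOr, Function.comp_def, Literal.subst_toFormula]

namespace Prov

variable {Γ Δ Θ : Set Formula} {n m k : ℕ} {A B X Y Z : Formula}

theorem subst_clauseFormula_imp {K : Clause} {σ : ℕ → Formula}
    (h : ∀ l ∈ K, Prov Γ n {imp (signed l.pos (σ l.var)) B}) :
    Prov Γ (K.card * (n + 1) + 1) {imp ((clauseFormula K).subst σ) B} := by
  rw [subst_clauseFormula]
  simpa using bigOr_imp (Γ := Γ) (n := n) (B := B)
    (l := K.toList.map fun l => signed l.pos (σ l.var)) (by simpa using h)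

theorem imp_subst_clauseFormula {K : Clause} {l : Literal} {σ : ℕ → Formula} (h : l ∈ K) :
    Prov Γ K.card {imp (signed l.pos (σ l.var)) ((clauseFormula K).subst σ)} := by
  rw [subst_clauseFormula]
  simpa using imp_bigOr (Γ := Γ) (A := signed l.pos (σ l.var))
    (l := K.toList.map fun l => signed l.pos (σ l.var))
    (List.mem_map.2 ⟨l, by simpa using h, rfl⟩)

variable {s x x₀ y : Formula} {p q b : Bool}

theorem congr (h : Prov Γ n {A}) (e : A = B) : Prov Γ n {B} := e ▸ h

theorem switch_of_not (h : iff y (switch s x x₀ p q) ∈ Γ)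
    (hB : Prov Γ n {imp (signed b y) B}) :
    Prov Γ (n + 1) {imp (signed b x) (imp (neg s) B)} := by
  refine (((rule2 [s, x, x₀, y, B] (iff (var 3) (switch (var 0) (var 1) (var 2) p q))
    (imp (signed b (var 3)) (var 4)) (imp (signed b (var 1)) (imp (neg (var 0)) (var 4)))
    (n := 0) (m := n) (hyp ?_) ?_ ?_ ?_).le (Nat.add_le_add_right (Nat.zero_add n).le 1)).congr ?_)
  · cases p <;> cases q <;> exact h
  · cases b <;> exact hB
  · intro v
    cases p <;> cases q <;> cases b <;> simp [Holds, switch, signed, ofBool] at * <;> tauto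
  · cases p <;> cases q <;> cases b <;> decide
  · cases b <;> rfl

/-- If the complement of the literal is not on a path, the switched value is `x` or combines `x` and
`x₀` in favour of this literal, so truth at `x` suffices. -/
theorem switch_of_eq_false (h : iff y (switch s x x₀ p q) ∈ Γ)
    (hB : Prov Γ n {imp (signed b y) B})
    (hpq : (if b then q else p) = false) :
    Prov Γ (n + 1) {imp (signed b x) (imp s B)} := by
  refine (((rule2 [s, x, x₀, y, B] (iff (var 3) (switch (var 0) (var 1) (var 2) p q))
    (imp (signed b (var 3)) (var 4)) (imp (signed b (var 1)) (imp (var 0) (var 4)))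
    (n := 0) (m := n) (hyp ?_) ?_ ?_ ?_).le (Nat.add_le_add_right (Nat.zero_add n).le 1)).congr ?_)
  · cases p <;> cases q <;> exact h
  · cases b <;> exact hB
  · intro v
    cases p <;> cases q <;> cases b <;> simp [Holds, switch, signed, ofBool] at * <;> tauto
  · cases p <;> cases q <;> cases b <;> decide
  · cases b <;> rfl

/-- If the literal is on a path, the switched value is `x₀` or combines `x` and `x₀` in favour of
this literal, so truth at `x₀` suffices. -/
theorem switch_of_eq_true (h : iff y (switch s x x₀ p q) ∈ Γ)
    (hB : Prov Γ n {imp (signed b y) B})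
    (hpq : (if b then p else q) = true) :
    Prov Γ (n + 1) {imp (signed b x₀) (imp s B)} := by
  refine (((rule2 [s, x, x₀, y, B] (iff (var 3) (switch (var 0) (var 1) (var 2) p q))
    (imp (signed b (var 3)) (var 4)) (imp (signed b (var 2)) (imp (var 0) (var 4)))
    (n := 0) (m := n) (hyp ?_) ?_ ?_ ?_).le (Nat.add_le_add_right (Nat.zero_add n).le 1)).congr ?_)
  · cases p <;> cases q <;> exact h
  · cases b <;> exact hB
  · intro v
    cases p <;> cases q <;> cases b <;> simp [Holds, switch, signed, ofBool] at * <;> tauto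
  · cases p <;> cases q <;> cases b <;> decide
  · cases b <;> rfl

/-- Each of the four switched values `x₀`, `x ∨ x₀`, `x ∧ x₀`, `x` agrees with `x` and `x₀` where
these agree, so no path information is needed. -/
theorem switch_of_both (h : iff y (switch s x x₀ p q) ∈ Γ)
    (hB : Prov Γ n {imp (signed b y) B}) :
    Prov Γ (n + 1) {imp (signed b x) (imp (signed b x₀) (imp s B))} := by
  refine (((rule2 [s, x, x₀, y, B] (iff (var 3) (switch (var 0) (var 1) (var 2) p q))
    (imp (signed b (var 3)) (var 4))
    (imp (signed b (var 1)) (imp (signed b (var 2)) (imp (var 0) (var 4))))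
    (n := 0) (m := n) (hyp ?_) ?_ ?_ ?_).le (Nat.add_le_add_right (Nat.zero_add n).le 1)).congr ?_)
  · cases p <;> cases q <;> exact h
  · cases b <;> exact hB
  · intro v
    cases p <;> cases q <;> cases b <;> simp [Holds, switch, signed, ofBool] at * <;> tauto
  · cases p <;> cases q <;> cases b <;> decide
  · cases b <;> rfl

theorem imp_imp (h : Prov Γ n {imp A B}) : Prov Γ (n + 1) {imp A (imp X B)} :=
  rule1 [A, B, X] (imp (var 0) (var 1)) (imp (var 0) (imp (var 2) (var 1))) h
    (by intro v; simp [Holds]; tauto)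

end Prov

/-! ### Propositional derivation of the copied clauses -/

/-- The conjunction of the clauses `O D` for `D ∈ χ`. -/
noncomputable def conjClauses (χ : Finset Clause) (O : Clause → Clause) : Formula :=
  bigAnd (χ.toList.map fun D => clauseFormula (O D))

/-- The lines from which the copy of the matrix is derived: the matrix `insert (insert u C) φ`,
its restriction to the falsified literal `u` over copies `σ₀ x` of the variables `x ∈ S`, the
clauses `C ∨ O D` for the clauses `D ∈ χ`, and the definitions of the new variables `ρ x`. -/
structure CopySetup (Γ : Set Formula) (m : ℕ) (φ : CNF) (C : Clause) (u : Literal)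
    (S : Finset ℕ) (χ : Finset Clause) (O : Clause → Clause) (σ₀ : ℕ → Formula)
    (ρ : ℕ → ℕ) (p q : ℕ → Bool) : Prop where
  var_notMem : u.var ∉ S
  card_chi : χ.card ≤ m
  card_clause : ∀ K ∈ insert (insert u C) φ, K.card ≤ m
  mem_chi : ∀ D, D ∈ χ ↔ D ∈ insert (insert u C) φ ∧
    PathClause (insert (insert u C) φ) {insert u C} S D ∧ u.neg ∈ D
  outer : ∀ D ∈ χ, ∀ k ∈ O D, k ∈ D ∧ k.var ∉ S ∧ k.var ≠ u.var
  path_true : ∀ x ∈ S, p x = true ↔ PathLit (insert (insert u C) φ) {insert u C} S ⟨x, true⟩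
  path_false : ∀ x ∈ S, q x = true ↔ PathLit (insert (insert u C) φ) {insert u C} S ⟨x, false⟩
  rho_of_notMem : ∀ x ∉ S, ρ x = x
  sigma_of_notMem : ∀ x ∉ S, x ≠ u.var → σ₀ x = var x
  sigma_var : σ₀ u.var = ofBool (!u.pos)
  mem_matrix : ∀ K ∈ insert (insert u C) φ, clauseFormula K ∈ Γ
  mem_restricted : ∀ K ∈ insert (insert u C) φ, (clauseFormula K).subst σ₀ ∈ Γ
  mem_outer : ∀ D ∈ χ, or (clauseFormula C) (clauseFormula (O D)) ∈ Γ
  mem_def : ∀ x ∈ S, iff (var (ρ x))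
    (switch (and (conjClauses χ O) u.toFormula) (var x) (σ₀ x) (p x) (q x)) ∈ Γ

namespace CopySetup

variable {Γ : Set Formula} {m : ℕ} {φ : CNF} {C : Clause} {u : Literal}
  {S : Finset ℕ} {χ : Finset Clause} {O : Clause → Clause} {σ₀ : ℕ → Formula}
  {ρ : ℕ → ℕ} {p q : ℕ → Bool} {K : Clause} {l : Literal} {B : Formula}

theorem imp_rename (hK : K.card ≤ m) (hl : l ∈ K) :
    Prov Γ m {imp (signed l.pos (var (ρ l.var))) (clauseFormula (renameClause ρ K))} :=
  (Prov.imp_clauseFormula (l := ⟨ρ l.var, l.pos⟩) (K := renameClause ρ K)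
    (Finset.mem_image_of_mem _ hl)).le (Finset.card_image_le.trans hK)

theorem imp_rename_of_notMem (h : CopySetup Γ m φ C u S χ O σ₀ ρ p q) (hK : K.card ≤ m)
    (hl : l ∈ K) (hlS : l.var ∉ S) :
    Prov Γ m {imp l.toFormula (clauseFormula (renameClause ρ K))} := by
  have := imp_rename (Γ := Γ) (ρ := ρ) hK hl
  rwa [h.rho_of_notMem _ hlS] at this

theorem literal_imp_not (h : CopySetup Γ m φ C u S χ O σ₀ ρ p q) (hK : K.card ≤ m)
    (hl : l ∈ K) :
    Prov Γ (m + 1) {imp l.toFormula (imp (neg (and (conjClauses χ O) u.toFormula))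
      (clauseFormula (renameClause ρ K)))} := by
  by_cases hlS : l.var ∈ S
  · exact Prov.switch_of_not (h.mem_def _ hlS) (imp_rename hK hl)
  · exact (h.imp_rename_of_notMem hK hl hlS).imp_imp

theorem ite_path (h : CopySetup Γ m φ C u S χ O σ₀ ρ p q) (hl : l.var ∈ S) :
    (if l.pos then p l.var else q l.var) = true ↔
      PathLit (insert (insert u C) φ) {insert u C} S l := by
  obtain ⟨x, b⟩ := l
  cases b
  · simpa using h.path_false x hl
  · simpa using h.path_true x hl

theorem ite_path_neg (h : CopySetup Γ m φ C u S χ O σ₀ ρ p q) (hl : l.var ∈ S) :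
    (if l.pos then q l.var else p l.var) = false ↔
      ¬ PathLit (insert (insert u C) φ) {insert u C} S l.neg := by
  obtain ⟨x, b⟩ := l
  rw [Bool.eq_false_iff, not_iff_not]
  cases b
  · exact h.path_true x hl
  · exact h.path_false x hl

theorem literal_imp (h : CopySetup Γ m φ C u S χ O σ₀ ρ p q) (hK : K.card ≤ m) (hl : l ∈ K)
    (hp : l.var ∈ S → ¬ PathLit (insert (insert u C) φ) {insert u C} S l.neg) :
    Prov Γ (m + 1) {imp l.toFormula (imp (and (conjClauses χ O) u.toFormula)
      (clauseFormula (renameClause ρ K)))} := by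
  by_cases hlS : l.var ∈ S
  · exact Prov.switch_of_eq_false (h.mem_def _ hlS) (imp_rename hK hl)
      ((h.ite_path_neg hlS).2 (hp hlS))
  · exact (h.imp_rename_of_notMem hK hl hlS).imp_imp

theorem restricted_literal_imp (h : CopySetup Γ m φ C u S χ O σ₀ ρ p q) (hK : K.card ≤ m)
    (hl : l ∈ K) (hlu : l.var ≠ u.var)
    (hp : l.var ∈ S → PathLit (insert (insert u C) φ) {insert u C} S l) :
    Prov Γ (m + 1) {imp (signed l.pos (σ₀ l.var)) (imp (and (conjClauses χ O) u.toFormula)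
      (clauseFormula (renameClause ρ K)))} := by
  by_cases hlS : l.var ∈ S
  · exact Prov.switch_of_eq_true (h.mem_def _ hlS) (imp_rename hK hl)
      ((h.ite_path hlS).2 (hp hlS))
  · rw [h.sigma_of_notMem _ hlS hlu]
    exact (h.imp_rename_of_notMem hK hl hlS).imp_imp

/-- When the switch is on, the outer clauses hold. -/
theorem rename_of_outer (h : CopySetup Γ m φ C u S χ O σ₀ ρ p q) (hK : K.card ≤ m)
    {D : Clause} (hD : D ∈ χ) (hDK : O D ⊆ K) :
    Prov Γ (m + (m * (m + 1) + 1) + 1) {imp (and (conjClauses χ O) u.toFormula)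
      (clauseFormula (renameClause ρ K))} := by
  have h1 : Prov Γ m {imp (conjClauses χ O) (clauseFormula (O D))} :=
    (Prov.bigAnd_imp (List.mem_map.2 ⟨D, by simpa using hD, rfl⟩)).le (by simpa using h.card_chi)
  have h2 : Prov Γ (m * (m + 1) + 1)
      {imp (clauseFormula (O D)) (clauseFormula (renameClause ρ K))} :=
    (Prov.clauseFormula_imp fun l hl =>
      h.imp_rename_of_notMem hK (hDK hl) (h.outer D hD l hl).2.1).le
      (by have := (Finset.card_le_card hDK).trans hK; gcongr)
  exact Prov.rule2 [conjClauses χ O, u.toFormula, clauseFormula (O D),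
    clauseFormula (renameClause ρ K)] (imp (var 0) (var 2)) (imp (var 2) (var 3))
    (imp (and (var 0) (var 1)) (var 3)) h1 h2 (by intro v; simp [Holds]; tauto)

theorem rename_of_mem (h : CopySetup Γ m φ C u S χ O σ₀ ρ p q) (hK : K.card ≤ m) (hu : u ∈ K) :
    Prov Γ (m + 1) {imp (and (conjClauses χ O) u.toFormula)
      (clauseFormula (renameClause ρ K))} :=
  Prov.rule1 [conjClauses χ O, u.toFormula, clauseFormula (renameClause ρ K)]
    (imp (var 1) (var 2)) (imp (and (var 0) (var 1)) (var 2))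
    (h.imp_rename_of_notMem hK hu h.var_notMem) (by intro v; simp [Holds]; tauto)

theorem ne_var (hu : u ∉ K) (hu' : u.neg ∉ K) (hl : l ∈ K) : l.var ≠ u.var := by
  rintro he
  obtain ⟨x, b⟩ := l
  obtain ⟨y, c⟩ := u
  obtain rfl : x = y := he
  cases b <;> cases c <;> simp_all [Literal.neg]

/-- Clauses of the original matrix hold for the copies when the switch is on. -/
theorem rename_on (h : CopySetup Γ m φ C u S χ O σ₀ ρ p q)
    (hKψ : K ∈ insert (insert u C) φ) :
    Prov Γ (6 * (m + 1) ^ 3) {imp (and (conjClauses χ O) u.toFormula)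
      (clauseFormula (renameClause ρ K))} := by
  have hK := h.card_clause K hKψ
  by_cases hu : u ∈ K
  · exact (h.rename_of_mem hK hu).le (by ring_nf; nlinarith [Nat.zero_le m])
  -- If no path enters `K`, every literal passes from `x` to `x'`, and the original clause gives the
  -- copy.
  by_cases hno : ∀ l ∈ K, l.var ∈ S → ¬ PathLit (insert (insert u C) φ) {insert u C} S l.neg
  · refine ((Prov.clauseFormula_imp fun l hl => h.literal_imp hK hl (hno l hl)).mp
      (Prov.hyp (n := 0) (h.mem_matrix K hKψ))).le ?_
    calc _ ≤ m * (m + 1 + 1) + 1 + 0 + 1 := by gcongr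
      _ ≤ _ := by ring_nf; nlinarith [Nat.zero_le m]
  push Not at hno
  obtain ⟨r, hr, hrS, hrp⟩ := hno
  have hnn : ∀ l : Literal, l.neg.neg = l := fun l => by simp [Literal.neg]
  have hpath : PathClause (insert (insert u C) φ) {insert u C} S K :=
    .inr ⟨hKψ, r.neg, hrp, by rwa [hnn]⟩
  by_cases hu' : u.neg ∈ K
  · have hχ := (h.mem_chi K).2 ⟨hKψ, hpath, hu'⟩
    exact (h.rename_of_outer hK hχ fun l hl => (h.outer K hχ l hl).1).le
      (by ring_nf; nlinarith [Nat.zero_le m])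
  -- A path enters `K` through `r`, so it leaves through every other `𝒮`-literal; these all pass
  -- from `x₀` to `x'`.
  have hq : ∀ l ∈ K, l ≠ r → l.var ∈ S → PathLit (insert (insert u C) φ) {insert u C} S l :=
    fun l hl hlr hlS => .step hrp hKψ (by rwa [hnn]) hl (by rwa [hnn]) hlS
  have hK₀ := Prov.hyp (n := 0) (h.mem_restricted K hKψ)
  by_cases hrp' : PathLit (insert (insert u C) φ) {insert u C} S r
  · refine ((Prov.subst_clauseFormula_imp fun l hl => h.restricted_literal_imp hK hl
      (ne_var hu hu' hl) fun hlS => ?_).mp hK₀).le ?_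
    · by_cases hlr : l = r
      · rwa [hlr]
      · exact hq l hl hlr hlS
    · calc _ ≤ m * (m + 1 + 1) + 1 + 0 + 1 := by gcongr
        _ ≤ _ := by ring_nf; nlinarith [Nat.zero_le m]
  -- Only `r` is not a path literal, so the case left open by the restricted clause is that `r`
  -- holds at `x₀`. The original clause settles it: either `r` also holds at `x`, or some other
  -- literal does, and that literal passes from `x` to `x'`.
  have h1 : Prov Γ (m * (m + 2 + 1) + 1 + 0 + 1) {imp (signed r.pos (σ₀ r.var))
      (imp (and (conjClauses χ O) u.toFormula) (clauseFormula (renameClause ρ K)))} := by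
    refine ((Prov.clauseFormula_imp (n := m + 2) fun l hl => ?_).mp
      (Prov.hyp (n := 0) (h.mem_matrix K hKψ))).le (by gcongr)
    by_cases hlr : l = r
    · subst hlr
      exact (Prov.switch_of_both (h.mem_def _ hrS) (imp_rename hK hl)).le (by omega)
    · refine Prov.rule1 [l.toFormula, signed r.pos (σ₀ r.var),
        imp (and (conjClauses χ O) u.toFormula) (clauseFormula (renameClause ρ K))]
        (imp (var 0) (var 2)) (imp (var 0) (imp (var 1) (var 2)))
        (h.literal_imp hK hl fun hlS hln => hrp' ?_) (by intro v; simp [Holds]; tauto)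
      -- A path entering `K` through `l ≠ r` would leave through `r` and make `r` a path literal.
      exact .step hln hKψ (by rwa [hnn]) hr (by rw [hnn]; exact Ne.symm hlr) hrS
  refine ((Prov.subst_clauseFormula_imp (n := m * (m + 2 + 1) + 2) fun l hl => ?_).mp
    hK₀).le (m := 6 * (m + 1) ^ 3) ?_
  · by_cases hlr : l = r
    · rwa [hlr]
    · exact (h.restricted_literal_imp hK hl (ne_var hu hu' hl) (hq l hl hlr)).le
        (by ring_nf; nlinarith [Nat.zero_le m])
  · calc _ ≤ m * (m * (m + 2 + 1) + 2 + 1) + 1 + 0 + 1 := by gcongr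
      _ ≤ _ := by ring_nf; nlinarith [Nat.zero_le m]

/-- In the main case the restriction of `C ∨ u` has lost `u`, and all `𝒮`-literals of `C` start
paths, so their truth passes from `x₀` to `x'`. If `ū ∈ C`, then `C ∨ u` is itself in `χ`, and its
outer clause avoids `var(u)`, hence lies in `C`. -/
theorem rename_on_residual (h : CopySetup Γ m φ C u S χ O σ₀ ρ p q) :
    Prov Γ (6 * (m + 1) ^ 3) {imp (and (conjClauses χ O) u.toFormula)
      (clauseFormula (renameClause ρ C))} := by
  have hm := h.card_clause (insert u C) (Finset.mem_insert_self _ _)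
  have hC : C.card ≤ m := (Finset.card_le_card (Finset.subset_insert u C)).trans hm
  by_cases hu : u ∈ C
  · exact (h.rename_of_mem hC hu).le (by ring_nf; nlinarith [Nat.zero_le m])
  by_cases hu' : u.neg ∈ C
  · have hχ := (h.mem_chi (insert u C)).2 ⟨Finset.mem_insert_self _ _,
      .inl (Finset.mem_singleton_self _), Finset.mem_insert_of_mem hu'⟩
    refine (h.rename_of_outer hC hχ fun l hl => ?_).le (by ring_nf; nlinarith [Nat.zero_le m])
    have := h.outer _ hχ l hl
    exact Finset.mem_of_mem_insert_of_ne this.1 fun he => this.2.2 (by rw [he])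
  refine ((Prov.subst_clauseFormula_imp (n := m + 1) fun l hl => ?_).mp
    (Prov.hyp (n := 0) (h.mem_restricted _ (Finset.mem_insert_self _ _)))).le ?_
  · rcases Finset.mem_insert.1 hl with rfl | hl'
    · rw [h.sigma_var]
      refine (Prov.rule0 [imp (and (conjClauses χ O) l.toFormula)
        (clauseFormula (renameClause ρ C))] (imp (signed l.pos (ofBool !l.pos)) (var 0)) ?_ ?_).le
        (Nat.le_add_left 1 m) |>.congr ?_
      · intro v; cases l.pos <;> simp [Holds, signed, ofBool]
      · cases l.pos <;> decide
      · cases l.pos <;> rfl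
    · exact h.restricted_literal_imp hC hl' (ne_var hu hu' hl')
        fun hlS => .init (Finset.mem_singleton_self _) (Finset.mem_insert_of_mem hl') hlS
  · calc _ ≤ m * (m + 1 + 1) + 1 + 0 + 1 := by gcongr
      _ ≤ _ := by ring_nf; nlinarith [Nat.zero_le m]

theorem rename_off (h : CopySetup Γ m φ C u S χ O σ₀ ρ p q)
    (hKψ : K ∈ insert (insert u C) φ) :
    Prov Γ (6 * (m + 1) ^ 3) {imp (neg (and (conjClauses χ O) u.toFormula))
      (clauseFormula (renameClause ρ K))} := by
  have hK := h.card_clause K hKψ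
  refine ((Prov.clauseFormula_imp fun l hl => h.literal_imp_not hK hl).mp
      (Prov.hyp (n := 0) (h.mem_matrix K hKψ))).le ?_
  calc _ ≤ m * (m + 1 + 1) + 1 + 0 + 1 := by gcongr
    _ ≤ _ := by ring_nf; nlinarith [Nat.zero_le m]

/-- When the switch is off, the residual clause `C` holds. -/
theorem rename_off_residual (h : CopySetup Γ m φ C u S χ O σ₀ ρ p q) :
    Prov Γ (6 * (m + 1) ^ 3) {imp (neg (and (conjClauses χ O) u.toFormula))
      (clauseFormula (renameClause ρ C))} := by
  have hm := h.card_clause (insert u C) (Finset.mem_insert_self _ _)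
  have hC : C.card ≤ m := (Finset.card_le_card (Finset.subset_insert u C)).trans hm
  -- If `C` fails, then `C ∨ O_D` makes all outer clauses true and `C ∨ u` makes `u` true, so the
  -- switch would be on.
  have h1 : Prov Γ (m * 2 + 1) {imp (neg (clauseFormula C)) (conjClauses χ O)} := by
    refine (Prov.imp_bigAnd (n := 1) fun A hA => ?_).le ?_
    · obtain ⟨D, hD, rfl⟩ := List.mem_map.1 hA
      exact Prov.rule1 [clauseFormula C, clauseFormula (O D)] (or (var 0) (var 1))
        (imp (neg (var 0)) (var 1)) (Prov.hyp (n := 0) (h.mem_outer D (by simpa using hD)))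
        (by intro v; simp [Holds]; tauto)
    · have := h.card_chi
      simp; omega
  have h2 : Prov Γ (m * (m + 1 + 1) + 1 + 0 + 1) {or (clauseFormula C) u.toFormula} := by
    refine ((Prov.clauseFormula_imp (n := m + 1) fun l hl => ?_).mp
      (Prov.hyp (n := 0) (h.mem_matrix _ (Finset.mem_insert_self _ _)))).le (by gcongr)
    rcases Finset.mem_insert.1 hl with rfl | hl'
    · exact (Prov.rule0 [clauseFormula C, l.toFormula] (imp (var 1) (or (var 0) (var 1)))
        (by intro v; simp [Holds]; tauto)).le (by omega)
    · exact Prov.rule1 [clauseFormula C, u.toFormula, l.toFormula] (imp (var 2) (var 0))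
        (imp (var 2) (or (var 0) (var 1))) ((Prov.imp_clauseFormula hl').le hC)
        (by intro v; simp [Holds]; tauto)
  have h3 : Prov Γ (m * (m + 2) + 1) {imp (clauseFormula C)
      (imp (neg (and (conjClauses χ O) u.toFormula)) (clauseFormula (renameClause ρ C)))} :=
    (Prov.clauseFormula_imp fun l hl => h.literal_imp_not hC hl).le (by gcongr)
  refine (Prov.rule3 [clauseFormula C, conjClauses χ O, u.toFormula,
    clauseFormula (renameClause ρ C)] (imp (neg (var 0)) (var 1)) (or (var 0) (var 2))
    (imp (var 0) (imp (neg (and (var 1) (var 2))) (var 3)))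
    (imp (neg (and (var 1) (var 2))) (var 3)) h1 h2 h3
    (by intro v; simp [Holds]; tauto)).le ?_
  ring_nf; nlinarith [Nat.zero_le m]

/-- The copies of the clauses of `insert C φ` have short proofs. -/
theorem rename (h : CopySetup Γ m φ C u S χ O σ₀ ρ p q) (hK : K ∈ insert C φ) :
    Prov Γ (13 * (m + 1) ^ 3) {clauseFormula (renameClause ρ K)} := by
  have key : ∀ {n : ℕ}, Prov Γ n {imp (and (conjClauses χ O) u.toFormula)
      (clauseFormula (renameClause ρ K))} → Prov Γ n {imp (neg (and (conjClauses χ O) u.toFormula))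
      (clauseFormula (renameClause ρ K))} → Prov Γ (n + n + 1) {clauseFormula (renameClause ρ K)} :=
    fun h1 h2 => Prov.rule2 [and (conjClauses χ O) u.toFormula, clauseFormula (renameClause ρ K)]
      (imp (var 0) (var 1)) (imp (neg (var 0)) (var 1)) (var 1) h1 h2
      (by intro v; simp [Holds])
  have hm : 1 ≤ (m + 1) ^ 3 := Nat.one_le_pow _ _ (Nat.succ_pos m)
  rcases Finset.mem_insert.1 hK with rfl | hK
  · exact (key h.rename_on_residual h.rename_off_residual).le (by omega)
  · have hK' := Finset.mem_insert_of_mem (b := insert u C) hK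
    exact (key (h.rename_on hK') (h.rename_off hK')).le (by omega)

end CopySetup

/-! ### Growing prefixes and reachable stages -/

/-- `P'` extends `P` by new existential variables. -/
structure DepPrefix.Le (P P' : DepPrefix) : Prop where
  univ_eq : P'.univ = P.univ
  exis_subset : P.exis ⊆ P'.exis
  dep_eq : ∀ x ∈ P.exis, P'.dep x = P.dep x

namespace DepPrefix

variable {P P' P'' : DepPrefix}

theorem Le.refl (P : DepPrefix) : P.Le P := ⟨rfl, subset_rfl, fun _ _ => rfl⟩

theorem Le.trans (h : P.Le P') (h' : P'.Le P'') : P.Le P'' :=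
  ⟨h'.1.trans h.1, h.2.trans h'.2, fun x hx => (h'.3 x (h.2 hx)).trans (h.3 x hx)⟩

theorem Le.vars_subset (h : P.Le P') : P.vars ⊆ P'.vars := by
  unfold vars
  rw [h.univ_eq]
  exact Finset.union_subset_union_right h.exis_subset

theorem Le.depSet_eq (h : P.Le P') {x : ℕ} (hx : x ∈ P.vars) : P'.depSet x = P.depSet x := by
  unfold depSet
  rcases Finset.mem_union.1 hx with hx | hx
  · rw [if_neg (Finset.disjoint_left.1 P.disjoint hx),
      if_neg (Finset.disjoint_left.1 P'.disjoint (h.univ_eq ▸ hx))]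
  · rw [if_pos hx, if_pos (h.exis_subset hx), h.dep_eq x hx]

theorem le_addExists (P : DepPrefix) (v : ℕ) (D : Finset ℕ) (hv : v ∉ P.vars)
    (hD : D ⊆ P.univ) : P.Le (P.addExists v D hv hD) := by
  refine ⟨rfl, Finset.subset_insert _ _, fun x hx => ?_⟩
  refine Function.update_of_ne ?_ _ _
  rintro rfl
  exact hv (Finset.mem_union_right _ hx)

theorem vars_addExists (P : DepPrefix) (v : ℕ) (D : Finset ℕ) (hv : v ∉ P.vars)
    (hD : D ⊆ P.univ) : (P.addExists v D hv hD).vars = insert v P.vars := by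
  simp [vars, addExists, Finset.union_insert]

/-- `v` is a variable of `P'` that is new over `P` and depends only on variables in `D`. -/
structure NewVar (P P' : DepPrefix) (v : ℕ) (D : Finset ℕ) : Prop where
  notMem : v ∉ P.vars
  mem : v ∈ P'.exis
  dep_subset : P'.dep v ⊆ D

theorem NewVar.trans_right {v : ℕ} {D : Finset ℕ} (h : NewVar P P' v D) (h' : P'.Le P'') :
    NewVar P P'' v D :=
  ⟨h.1, h'.2 h.2, by rw [h'.3 v h.2]; exact h.3⟩

theorem NewVar.trans_left {v : ℕ} {D : Finset ℕ} (h : P.Le P') (h' : NewVar P' P'' v D) :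
    NewVar P P'' v D :=
  ⟨fun hv => h'.1 (h.vars_subset hv), h'.2, h'.3⟩

theorem NewVar.mem_vars {v : ℕ} {D : Finset ℕ} (h : NewVar P P' v D) : v ∈ P'.vars :=
  Finset.mem_union_right _ h.mem

end DepPrefix

/-- All lines contain only quantified variables. -/
def Stage.Scoped (s : Stage) : Prop := ∀ L ∈ s.lines, L.vars ⊆ s.pre.vars

/-- `t` is reached from `s` by exactly `n` rule applications. -/
inductive Chain (F : FregeSystem) (M : Set Formula) (s : Stage) : ℕ → Stage → Prop
  | refl : Chain F M s 0 s
  | step {n : ℕ} {t t' : Stage} : Chain F M s n t → Step F M t t' → Chain F M s (n + 1) t'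

theorem Chain.trans {F : FregeSystem} {M : Set Formula} {s t t' : Stage} {n m : ℕ}
    (h : Chain F M s n t) (h' : Chain F M t m t') : Chain F M s (n + m) t' := by
  induction h' with
  | refl => exact h
  | step _ h2 ih => exact .step ih h2

theorem Chain.derives {F : FregeSystem} {Q : DQBF} {s : Stage} {n : ℕ}
    (h : Chain F {L | ∃ K ∈ Q.matrix, L = clauseFormula K} ⟨Q.pre, []⟩ n s) :
    Derives F Q n s := by
  induction h with
  | refl => exact .start
  | step _ h ih => exact .step ih h

/-- `t` is reached from `s` by at most `n` rule applications, which only add lines and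
existential variables and keep the lines scoped. -/
structure Reaches (F : FregeSystem) (M : Set Formula) (n : ℕ) (s t : Stage) : Prop where
  chain : ∃ k ≤ n, Chain F M s k t
  pre_le : s.pre.Le t.pre
  lines_subset : s.lines ⊆ t.lines
  preserves : s.Scoped → t.Scoped

namespace Reaches

variable {F : FregeSystem} {M : Set Formula} {s t t' : Stage} {n m : ℕ}

theorem refl (F : FregeSystem) (M : Set Formula) (n : ℕ) (s : Stage) : Reaches F M n s s :=
  ⟨⟨0, Nat.zero_le _, .refl⟩, .refl _, List.Subset.refl _, id⟩

theorem trans (h : Reaches F M n s t) (h' : Reaches F M m t t') : Reaches F M (n + m) s t' := by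
  obtain ⟨k, hk, hc⟩ := h.chain
  obtain ⟨k', hk', hc'⟩ := h'.chain
  exact ⟨⟨k + k', Nat.add_le_add hk hk', hc.trans hc'⟩, h.pre_le.trans h'.pre_le,
    List.Subset.trans h.lines_subset h'.lines_subset, fun hs => h'.preserves (h.preserves hs)⟩

theorem le (h : Reaches F M n s t) (hn : n ≤ m) : Reaches F M m s t := by
  obtain ⟨k, hk, hc⟩ := h.chain
  exact ⟨⟨k, hk.trans hn, hc⟩, h.2, h.3, h.4⟩

theorem of_step {P P' : DepPrefix} {Γ : List Formula} {L : Formula}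
    (h : Step F M ⟨P, Γ⟩ ⟨P', L :: Γ⟩) (hP : P.Le P') (hL : L.vars ⊆ P'.vars) :
    Reaches F M 1 ⟨P, Γ⟩ ⟨P', L :: Γ⟩ := by
  refine ⟨⟨1, le_rfl, .step .refl h⟩, hP, List.subset_cons_self _ _, fun hs A hA => ?_⟩
  rcases List.mem_cons.1 hA with rfl | hA
  · exact hL
  · exact (hs A hA).trans hP.vars_subset

end Reaches

/-! ### Simulation of the auxiliary calculus by an arbitrary Frege system -/

/-- Every derivation in a Frege system has a length that bounds that of all its instances. -/
theorem FregeDerivable.exists_bound {F : FregeSystem} {G : List Formula} {B : Formula}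
    (h : FregeDerivable F.rules G B) :
    ∃ N, ∀ (M : Set Formula) (P : DepPrefix) (σ : ℕ → Formula) (Γ : List Formula),
      (∀ i, (σ i).vars ⊆ P.vars) → (∀ A ∈ G, A.subst σ ∈ Γ) →
      ∃ Γ', Reaches F M N ⟨P, Γ⟩ ⟨P, Γ'⟩ ∧ B.subst σ ∈ Γ' := by
  induction h with
  | hyp hA => exact ⟨0, fun M P σ Γ _ h => ⟨Γ, .refl _ _ _ _, h _ hA⟩⟩
  | @rule r τ hr _ ih =>
    -- The premises are derived one after another, so that a single bound, the sum of theirs, serves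
    -- all substitutions.
    have key : ∀ l ⊆ r.premises, ∃ N, ∀ (M : Set Formula) (P : DepPrefix) (σ : ℕ → Formula)
        (Γ : List Formula), (∀ i, (σ i).vars ⊆ P.vars) → (∀ A ∈ G, A.subst σ ∈ Γ) →
        ∃ Γ', Reaches F M N ⟨P, Γ⟩ ⟨P, Γ'⟩ ∧ ∀ A ∈ l, (A.subst τ).subst σ ∈ Γ' := by
      intro l hl
      induction l with
      | nil => exact ⟨0, fun M P σ Γ _ _ => ⟨Γ, .refl _ _ _ _, by simp⟩⟩
      | cons A l ihl =>
        obtain ⟨N₁, h₁⟩ := ih A (hl (by simp))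
        obtain ⟨N₂, h₂⟩ := ihl fun B hB => hl (by simp [hB])
        refine ⟨N₁ + N₂, fun M P σ Γ hσ hG => ?_⟩
        obtain ⟨Γ₁, hr₁, hm₁⟩ := h₁ M P σ Γ hσ hG
        obtain ⟨Γ₂, hr₂, hm₂⟩ := h₂ M P σ Γ₁ hσ fun B hB => hr₁.lines_subset (hG B hB)
        refine ⟨Γ₂, hr₁.trans hr₂, fun B hB => ?_⟩
        rcases List.mem_cons.1 hB with rfl | hB
        · exact hr₂.lines_subset hm₁
        · exact hm₂ B hB
    obtain ⟨N, hN⟩ := key _ (List.Subset.refl _)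
    refine ⟨N + 1, fun M P σ Γ hσ hG => ?_⟩
    obtain ⟨Γ', hr', hm'⟩ := hN M P σ Γ hσ hG
    have hv : ((r.conclusion.subst τ).subst σ).vars ⊆ P.vars :=
      vars_subst_subset fun x _ => hσ x
    simp only [subst_subst] at hm' hv ⊢
    exact ⟨_, hr'.trans (.of_step (.frege P Γ' r _ hr hm' hv) (.refl _) hv), List.mem_cons_self⟩

/-- Every small sound inference takes at most `N` steps of the Frege system. -/
def Simulates (F : FregeSystem) (N : ℕ) : Prop :=
  ∀ (G : List Formula) (B : Formula), G.length ≤ 4 → (∀ A ∈ G, A.weight ≤ 100) →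
    B.weight ≤ 100 → Entails G B →
    ∀ (M : Set Formula) (P : DepPrefix) (σ : ℕ → Formula) (Γ : List Formula),
      (∀ i, (σ i).vars ⊆ P.vars) → (∀ A ∈ G, A.subst σ ∈ Γ) →
      ∃ Γ', Reaches F M N ⟨P, Γ⟩ ⟨P, Γ'⟩ ∧ B.subst σ ∈ Γ'

theorem finite_lists {S : Set Formula} (hS : S.Finite) (n : ℕ) :
    {G : List Formula | G.length ≤ n ∧ ∀ A ∈ G, A ∈ S}.Finite := by
  induction n with
  | zero =>
    refine (Set.finite_singleton []).subset fun G hG => ?_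
    simpa using hG.1
  | succ n ih =>
    refine ((Set.finite_singleton []).union (hS.image2 List.cons ih)).subset fun G hG => ?_
    cases G with
    | nil => exact .inl rfl
    | cons A G =>
      refine .inr ⟨A, hG.2 A (by simp), G, ⟨by simpa using hG.1, fun B hB => ?_⟩, rfl⟩
      exact hG.2 B (by simp [hB])

/-- Implicational completeness gives a bound for each sound schema. Only finitely many schemata have
at most four premises and weight at most `100`, so the maximum of these bounds exists. -/
theorem exists_simulates (F : FregeSystem) : ∃ N, Simulates F N := by
  classical
  have h : ∀ (G : List Formula) (B : Formula), ∃ N, Entails G B →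
    ∀ (M : Set Formula) (P : DepPrefix) (σ : ℕ → Formula) (Γ : List Formula),
      (∀ i, (σ i).vars ⊆ P.vars) → (∀ A ∈ G, A.subst σ ∈ Γ) →
      ∃ Γ', Reaches F M N ⟨P, Γ⟩ ⟨P, Γ'⟩ ∧ B.subst σ ∈ Γ' := by
    intro G B
    by_cases hGB : Entails G B
    · obtain ⟨N, hN⟩ := (F.complete G B hGB).exists_bound
      exact ⟨N, fun _ => hN⟩
    · exact ⟨0, fun h => absurd h hGB⟩
  choose N hN using h
  have hfin := (finite_lists (finite_weight_le 100) 4).image2 N (finite_weight_le 100)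
  obtain ⟨b, hb⟩ := hfin.bddAbove
  refine ⟨b, fun G B h1 h2 h3 h4 M P σ Γ h5 h6 => ?_⟩
  obtain ⟨Γ', hr, hm⟩ := hN G B h4 M P σ Γ h5 h6
  exact ⟨Γ', hr.le (hb ⟨G, ⟨h1, h2⟩, B, h3, rfl⟩), hm⟩

/-- Intermediate lines of an auxiliary proof may mention unquantified variables, which the rules
forbid. Substituting `tru` for these throughout preserves every inference and fixes the hypotheses,
which are scoped. -/
theorem Simulates.derivation {F : FregeSystem} {N : ℕ} (hN : Simulates F N) (M : Set Formula)
    {s : Stage} (hs : s.Scoped) {l : List Formula} (hl : Derivation {L | L ∈ s.lines} l) :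
    ∃ Γ', Reaches F M (N * l.length) s ⟨s.pre, Γ'⟩ ∧
      ∀ L ∈ l, L.subst (fun i => if i ∈ s.pre.vars then var i else tru) ∈ Γ' := by
  induction hl with
  | nil => exact ⟨s.lines, .refl _ _ _ _, by simp⟩
  | @cons L l _ h ih =>
    obtain ⟨Γ₁, hr₁, hm₁⟩ := ih
    obtain ⟨G, B, σ, ⟨h1, h2, h3⟩, h4, h5, rfl⟩ := h
    have hσ : ∀ i, ((σ i).subst fun i => if i ∈ s.pre.vars then var i else tru).vars ⊆
        s.pre.vars := by
      refine fun i => vars_subst_subset fun x _ => ?_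
      split_ifs with h
      · simpa [vars] using h
      · simp [vars]
    obtain ⟨Γ₂, hr₂, hm₂⟩ := hN G B h1 h2 h3 h4 M s.pre _ Γ₁ hσ fun A hA => by
      rw [← subst_subst]
      rcases h5 A hA with h | h
      · rw [subst_congr (τ := var) fun x hx => if_pos (hs _ h hx), subst_var]
        exact hr₁.lines_subset h
      · exact hm₁ _ h
    refine ⟨Γ₂, hr₁.trans hr₂, fun A hA => ?_⟩
    rcases List.mem_cons.1 hA with rfl | hA
    · rwa [subst_subst]
    · exact hr₂.lines_subset (hm₁ A hA)

theorem Simulates.prov {F : FregeSystem} {N : ℕ} (hN : Simulates F N) (M : Set Formula)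
    {s : Stage} (hs : s.Scoped) {n : ℕ} {Δ : Set Formula} (h : Prov {L | L ∈ s.lines} n Δ)
    (hΔ : ∀ B ∈ Δ, B.vars ⊆ s.pre.vars) :
    ∃ Γ', Reaches F M (N * n) s ⟨s.pre, Γ'⟩ ∧ ∀ B ∈ Δ, B ∈ Γ' := by
  obtain ⟨l, hl, hln, hlΔ⟩ := h
  obtain ⟨Γ', hr, hm⟩ := hN.derivation M hs hl
  refine ⟨Γ', hr.le (Nat.mul_le_mul_left _ hln), fun B hB => ?_⟩
  rcases hlΔ hB with h | h
  · exact hr.lines_subset h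
  · have := hm B h
    rwa [subst_congr (τ := var) fun x hx => if_pos (hΔ B hB hx), subst_var] at this

theorem vars_toFormula (l : Literal) : l.toFormula.vars = {l.var} := by
  obtain ⟨x, b⟩ := l
  cases b <;> rfl

theorem vars_bigOr_subset {l : List Formula} {V : Finset ℕ} (h : ∀ A ∈ l, A.vars ⊆ V) :
    (bigOr l).vars ⊆ V := by
  induction l with
  | nil => simp [bigOr, vars]
  | cons a l ih =>
    exact Finset.union_subset (h a (by simp)) (ih fun A hA => h A (by simp [hA]))

theorem vars_bigAnd_subset {l : List Formula} {V : Finset ℕ} (h : ∀ A ∈ l, A.vars ⊆ V) :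
    (bigAnd l).vars ⊆ V := by
  induction l with
  | nil => simp [bigAnd, vars]
  | cons a l ih =>
    exact Finset.union_subset (h a (by simp)) (ih fun A hA => h A (by simp [hA]))

theorem vars_clauseFormula_subset {K : Finset Literal} {V : Finset ℕ} (h : ∀ l ∈ K, l.var ∈ V) :
    (clauseFormula K).vars ⊆ V :=
  vars_bigOr_subset fun A hA => by
    obtain ⟨l, hl, rfl⟩ := List.mem_map.1 hA
    simpa [vars_toFormula] using h l (by simpa using hl)

theorem vars_conjFormula_subset {K : Finset Literal} {V : Finset ℕ} (h : ∀ l ∈ K, l.var ∈ V) :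
    (conjFormula K).vars ⊆ V :=
  vars_bigAnd_subset fun A hA => by
    obtain ⟨l, hl, rfl⟩ := List.mem_map.1 hA
    simpa [vars_toFormula] using h l (by simpa using hl)

/-! ### Extension, reduction and their iteration -/

namespace Reaches

variable {F : FregeSystem} {M : Set Formula} {s : Stage}

theorem exists_extAnd (F : FregeSystem) (M : Set Formula) (s : Stage) (α Y : Finset Literal)
    (hα : ∀ a ∈ α, a.var ∈ s.pre.univ) (hY : ∀ y ∈ Y, y.var ∈ s.pre.vars) :
    ∃ t v, Reaches F M 1 s t ∧ s.pre.NewVar t.pre v (s.pre.extDep α Y) ∧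
      imp (conjFormula α) (iff (var v) (conjFormula Y)) ∈ t.lines := by
  obtain ⟨v, hv⟩ := Infinite.exists_notMem_finset s.pre.vars
  refine ⟨_, v, of_step (.indExtAnd s.pre s.lines α Y v hα hY hv)
    (DepPrefix.le_addExists _ _ _ _ _) ?_, ⟨hv, Finset.mem_insert_self _ _, ?_⟩,
    List.mem_cons_self⟩
  · rw [DepPrefix.vars_addExists]
    refine Finset.union_subset ((vars_conjFormula_subset fun l hl =>
      Finset.mem_union_left _ (hα l hl)).trans (Finset.subset_insert _ _)) ?_
    refine Finset.union_subset (by simp [vars])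
      ((vars_conjFormula_subset hY).trans (Finset.subset_insert _ _))
  · simp [DepPrefix.addExists]

theorem exists_extOr (F : FregeSystem) (M : Set Formula) (s : Stage) (α Y : Finset Literal)
    (hα : ∀ a ∈ α, a.var ∈ s.pre.univ) (hY : ∀ y ∈ Y, y.var ∈ s.pre.vars) :
    ∃ t v, Reaches F M 1 s t ∧ s.pre.NewVar t.pre v (s.pre.extDep α Y) ∧
      imp (conjFormula α) (iff (var v) (clauseFormula Y)) ∈ t.lines := by
  obtain ⟨v, hv⟩ := Infinite.exists_notMem_finset s.pre.vars
  refine ⟨_, v, of_step (.indExtOr s.pre s.lines α Y v hα hY hv)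
    (DepPrefix.le_addExists _ _ _ _ _) ?_, ⟨hv, Finset.mem_insert_self _ _, ?_⟩,
    List.mem_cons_self⟩
  · rw [DepPrefix.vars_addExists]
    refine Finset.union_subset ((vars_conjFormula_subset fun l hl =>
      Finset.mem_union_left _ (hα l hl)).trans (Finset.subset_insert _ _)) ?_
    refine Finset.union_subset (by simp [vars])
      ((vars_clauseFormula_subset hY).trans (Finset.subset_insert _ _))
  · simp [DepPrefix.addExists]

theorem of_red (L : Formula) (u : ℕ) (b : Bool)
    (hLs : L ∈ s.lines) (hu : u ∈ s.pre.univ)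
    (hd : ∀ x ∈ L.vars, x ∈ s.pre.exis → u ∉ s.pre.dep x) (hs : s.Scoped) :
    Reaches F M 1 s ⟨s.pre, L.replace u (ofBool b) :: s.lines⟩ := by
  refine of_step ?_ (.refl _) (vars_subst_subset fun x hx => ?_)
  · cases b
    · exact .red0 _ _ _ _ hLs hu hd
    · exact .red1 _ _ _ _ hLs hu hd
  · by_cases hxu : x = u
    · subst hxu
      cases b <;> simp [ofBool, vars]
    · simpa [Function.update_of_ne hxu, vars] using hs L hLs hx

/-- Successive steps that each preserve the prefix give all their lines together. -/
theorem family {ι : Type*} (I : Finset ι) {n : ℕ} (L : ι → Formula) (s : Stage)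
    (h : ∀ i ∈ I, ∀ Γ, s.lines ⊆ Γ → Stage.Scoped ⟨s.pre, Γ⟩ →
      ∃ Γ', Reaches F M n ⟨s.pre, Γ⟩ ⟨s.pre, Γ'⟩ ∧ L i ∈ Γ') (hs : s.Scoped) :
    ∃ Γ', Reaches F M (I.card * n) s ⟨s.pre, Γ'⟩ ∧ ∀ i ∈ I, L i ∈ Γ' := by
  classical
  induction I using Finset.induction_on with
  | empty => exact ⟨s.lines, .refl _ _ _ _, by simp⟩
  | insert a I ha ih =>
    obtain ⟨Γ₁, hr₁, hm₁⟩ := ih fun i hi => h i (by simp [hi])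
    obtain ⟨Γ₂, hr₂, hm₂⟩ := h a (by simp) Γ₁ hr₁.lines_subset (hr₁.preserves hs)
    refine ⟨Γ₂, (hr₁.trans hr₂).le ?_, fun i hi => ?_⟩
    · rw [Finset.card_insert_of_notMem ha, add_mul, one_mul]
    · rcases Finset.mem_insert.1 hi with rfl | hi
      · exact hm₂
      · exact hr₂.lines_subset (hm₁ i hi)

/-- Successive additions of new variables. -/
theorem exists_newVars (S : Finset ℕ) {n : ℕ} (D : ℕ → Finset ℕ) (L : ℕ → ℕ → Formula) (s : Stage)
    (h : ∀ x ∈ S, ∀ t : Stage, t.Scoped → s.pre.Le t.pre → s.lines ⊆ t.lines →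
      ∃ t' v, Reaches F M n t t' ∧ t.pre.NewVar t'.pre v (D x) ∧ L x v ∈ t'.lines)
    (hs : s.Scoped) :
    ∃ t f, Reaches F M (S.card * n) s t ∧ Set.InjOn f S ∧
      ∀ x ∈ S, s.pre.NewVar t.pre (f x) (D x) ∧ L x (f x) ∈ t.lines := by
  induction S using Finset.induction_on with
  | empty => exact ⟨s, id, .refl _ _ _ _, by simp, by simp⟩
  | insert a S ha ih =>
    obtain ⟨t, f, hr, hi, hf⟩ := ih fun x hx => h x (by simp [hx])
    obtain ⟨t', v, hr', hv, hm⟩ := h a (by simp) t (hr.preserves hs) hr.pre_le hr.lines_subset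
    have hne : ∀ x ∈ S, x ≠ a := fun x hx hxa => ha (hxa ▸ hx)
    refine ⟨t', Function.update f a v, (hr.trans hr').le ?_, ?_, ?_⟩
    · rw [Finset.card_insert_of_notMem ha, add_mul, one_mul]
    · rw [Finset.coe_insert, Set.injOn_insert (by simpa using ha)]
      refine ⟨fun x hx y hy hxy => ?_, ?_⟩
      · rw [Function.update_of_ne (hne x hx), Function.update_of_ne (hne y hy)] at hxy
        exact hi hx hy hxy
      -- Freshness of each new variable over the current prefix makes the copies pairwise distinct.
      · rintro ⟨x, hx, hxv⟩
        rw [Function.update_of_ne (hne x hx), Function.update_self] at hxv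
        exact hv.notMem (hxv ▸ (hf x hx).1.mem_vars)
    · intro x hx
      by_cases hxa : x = a
      · subst hxa
        rw [Function.update_self]
        exact ⟨hv.trans_left hr.pre_le, hm⟩
      · rw [Function.update_of_ne hxa]
        have := hf x (Finset.mem_of_mem_insert_of_ne hx hxa)
        exact ⟨this.1.trans_right hr'.pre_le, hr'.lines_subset this.2⟩

end Reaches

/-! ### Naming a formula by an extension variable -/

namespace Formula

/-- The number of nodes of a formula. -/
def nodes : Formula → ℕ
  | fls => 1
  | tru => 1
  | var _ => 1
  | neg a => a.nodes + 1
  | and a b => a.nodes + b.nodes + 1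
  | or a b => a.nodes + b.nodes + 1
  | imp a b => a.nodes + b.nodes + 1
  | iff a b => a.nodes + b.nodes + 1

/-- Formulas without implications and equivalences. -/
inductive Basic : Formula → Prop
  | fls : Basic fls
  | tru : Basic tru
  | var (x : ℕ) : Basic (var x)
  | neg {a : Formula} : Basic a → Basic (neg a)
  | and {a b : Formula} : Basic a → Basic b → Basic (and a b)
  | or {a b : Formula} : Basic a → Basic b → Basic (or a b)

theorem nodes_bigAnd_le {l : List Formula} {k : ℕ} (h : ∀ A ∈ l, A.nodes ≤ k) :
    (bigAnd l).nodes ≤ l.length * (k + 1) + 1 := by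
  induction l with
  | nil => simp [bigAnd, nodes]
  | cons a l ih =>
    have h1 := h a (by simp)
    have h2 := ih fun A hA => h A (by simp [hA])
    change a.nodes + (bigAnd l).nodes + 1 ≤ _
    rw [List.length_cons, add_mul]
    omega

theorem nodes_bigOr_le {l : List Formula} {k : ℕ} (h : ∀ A ∈ l, A.nodes ≤ k) :
    (bigOr l).nodes ≤ l.length * (k + 1) + 1 := by
  induction l with
  | nil => simp [bigOr, nodes]
  | cons a l ih =>
    have h1 := h a (by simp)
    have h2 := ih fun A hA => h A (by simp [hA])
    change a.nodes + (bigOr l).nodes + 1 ≤ _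
    rw [List.length_cons, add_mul]
    omega

theorem Basic.bigAnd {l : List Formula} (h : ∀ A ∈ l, Basic A) : Basic (bigAnd l) := by
  induction l with
  | nil => exact .tru
  | cons a l ih => exact .and (h a (by simp)) (ih fun A hA => h A (by simp [hA]))

theorem Basic.bigOr {l : List Formula} (h : ∀ A ∈ l, Basic A) : Basic (bigOr l) := by
  induction l with
  | nil => exact .fls
  | cons a l ih => exact .or (h a (by simp)) (ih fun A hA => h A (by simp [hA]))

theorem Basic.toFormula (l : Literal) : Basic l.toFormula := by
  obtain ⟨x, b⟩ := l
  cases b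
  · exact .neg (.var x)
  · exact .var x

theorem Basic.clauseFormula (K : Clause) : Basic (clauseFormula K) :=
  .bigOr fun A hA => by
    obtain ⟨l, -, rfl⟩ := List.mem_map.1 hA
    exact .toFormula l

theorem Basic.ofBool (b : Bool) : Basic (ofBool b) := by
  cases b
  · exact .fls
  · exact .tru

theorem Basic.switch {s x x₀ : Formula} (hs : Basic s) (hx : Basic x) (hx₀ : Basic x₀)
    (p q : Bool) : Basic (switch s x x₀ p q) :=
  .or (.and hs (.and hx₀ (.ofBool p))) (.and hx (.or (.neg hs) (.or hx₀ (.neg (.ofBool q)))))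

theorem nodes_toFormula_le (l : Literal) : l.toFormula.nodes ≤ 2 := by
  obtain ⟨x, b⟩ := l
  cases b <;> simp [Literal.toFormula, nodes]

theorem nodes_clauseFormula_le (K : Clause) : (DFrege.clauseFormula K).nodes ≤ 3 * K.card + 1 := by
  have := nodes_bigOr_le (l := K.toList.map Literal.toFormula) (k := 2) fun A hA => by
    obtain ⟨l, -, rfl⟩ := List.mem_map.1 hA
    exact nodes_toFormula_le l
  rw [List.length_map, Finset.length_toList] at this
  rw [DFrege.clauseFormula]
  omega

theorem nodes_switch {s x x₀ : Formula} {p q : Bool} :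
    (switch s x x₀ p q).nodes = 2 * s.nodes + x.nodes + 2 * x₀.nodes + 10 := by
  cases p <;> cases q <;> simp only [switch, nodes, ofBool] <;> simp [nodes] <;> omega

theorem vars_switch {s x x₀ : Formula} {p q : Bool} :
    (switch s x x₀ p q).vars = s.vars ∪ x.vars ∪ x₀.vars := by
  ext a
  cases p <;> cases q <;> simp [switch, vars, ofBool] <;> tauto

end Formula

theorem conjFormula_empty : conjFormula ∅ = tru := by simp [conjFormula, bigAnd]

theorem clauseFormula_empty : clauseFormula ∅ = fls := by simp [clauseFormula, bigOr]

theorem conjFormula_singleton (l : Literal) : conjFormula {l} = and l.toFormula tru := by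
  simp [conjFormula, bigAnd]

/-- The order in which a set of literals is listed is unspecified, so extension lines over two
literals must be treated in both orders. -/
theorem toList_pair {l l' : Literal} (h : l ≠ l') :
    ({l, l'} : Finset Literal).toList = [l, l'] ∨ ({l, l'} : Finset Literal).toList = [l', l] := by
  have := Finset.toList_insert (a := l) (s := {l'}) (by simpa using h)
  rw [Finset.toList_singleton] at this
  exact List.perm_pair.1 this

namespace Reaches

variable {F : FregeSystem} {M : Set Formula} {s : Stage} {N n : ℕ} {D : Finset ℕ}

theorem exists_def_of (hN : Simulates F N) (hs : s.Scoped) {G : Formula}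
    (hG : G.vars ⊆ s.pre.vars) {D' : Finset ℕ} (hD : D' ⊆ D) {E : ℕ → Formula}
    (h : ∃ t v, Reaches F M 1 s t ∧ s.pre.NewVar t.pre v D' ∧ E v ∈ t.lines)
    (hp : ∀ v, Prov ({L | L ∈ s.lines} ∪ {E v}) 1 {iff (var v) G}) :
    ∃ t v, Reaches F M (N + 1) s t ∧ s.pre.NewVar t.pre v D ∧ iff (var v) G ∈ t.lines := by
  obtain ⟨t, v, hr, hv, hE⟩ := h
  obtain ⟨Γ', hr', hm⟩ := hN.prov M (hr.preserves hs) (Δ := {iff (var v) G}) (n := 1)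
    ((hp v).mono (Set.union_subset hr.lines_subset (by simpa using hE))) (by
      simpa [vars, Finset.insert_subset_iff] using
        ⟨hv.mem_vars, hG.trans hr.pre_le.vars_subset⟩)
  exact ⟨_, v, (hr.trans hr').le (by omega), ⟨hv.1, hv.2, hv.3.trans hD⟩, hm _ rfl⟩

theorem extDep_subset_of {P : DepPrefix} {Y : Finset Literal}
    (h : ∀ y ∈ Y, P.depSet y.var ⊆ D) : P.extDep ∅ Y ⊆ D :=
  Finset.sdiff_subset.trans (Finset.biUnion_subset.2 h)

theorem depSet_newVar_subset {P P' : DepPrefix} {v : ℕ} (h : P.NewVar P' v D) :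
    P'.depSet v ⊆ D := by
  rw [DepPrefix.depSet, if_pos h.mem]
  exact h.dep_subset

/-- One extension with empty `α` per node of `G`, from the leaves up; each definition then unfolds
to the subformula by one small inference. All dependency sets stay within `D` because those of the
leaves do. -/
theorem exists_def (hN : Simulates F N) {G : Formula} (hG : G.Basic) (hs : s.Scoped)
    (hGs : G.vars ⊆ s.pre.vars) (hD : ∀ x ∈ G.vars, s.pre.depSet x ⊆ D) :
    ∃ t v, Reaches F M (G.nodes * (N + 1)) s t ∧ s.pre.NewVar t.pre v D ∧
      iff (var v) G ∈ t.lines := by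
  -- Both arguments of a connective are named first. The names must differ, since the extension rule
  -- takes a set of literals.
  have binary : ∀ {a b : Formula},
      (∀ {s : Stage}, s.Scoped → a.vars ⊆ s.pre.vars → (∀ x ∈ a.vars, s.pre.depSet x ⊆ D) →
        ∃ t v, Reaches F M (a.nodes * (N + 1)) s t ∧ s.pre.NewVar t.pre v D ∧
          iff (var v) a ∈ t.lines) →
      (∀ {s : Stage}, s.Scoped → b.vars ⊆ s.pre.vars → (∀ x ∈ b.vars, s.pre.depSet x ⊆ D) →
        ∃ t v, Reaches F M (b.nodes * (N + 1)) s t ∧ s.pre.NewVar t.pre v D ∧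
          iff (var v) b ∈ t.lines) →
      ∀ {s : Stage}, s.Scoped → a.vars ∪ b.vars ⊆ s.pre.vars →
      (∀ x ∈ a.vars ∪ b.vars, s.pre.depSet x ⊆ D) →
      ∃ t v₁ v₂, Reaches F M ((a.nodes + b.nodes) * (N + 1)) s t ∧ t.Scoped ∧ v₁ ≠ v₂ ∧
        (∀ y ∈ ({⟨v₁, true⟩, ⟨v₂, true⟩} : Finset Literal), y.var ∈ t.pre.vars) ∧
        (∀ y ∈ ({⟨v₁, true⟩, ⟨v₂, true⟩} : Finset Literal), t.pre.depSet y.var ⊆ D) ∧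
        iff (var v₁) a ∈ t.lines ∧ iff (var v₂) b ∈ t.lines := by
    intro a b iha ihb s hs hsub hdep
    obtain ⟨t₁, v₁, hr₁, hv₁, hl₁⟩ := iha hs (Finset.union_subset_left hsub)
      fun x hx => hdep x (Finset.mem_union_left _ hx)
    have hs₁ := hr₁.preserves hs
    have hb := Finset.union_subset_right hsub
    obtain ⟨t₂, v₂, hr₂, hv₂, hl₂⟩ := ihb hs₁ (hb.trans hr₁.pre_le.vars_subset)
      fun x hx => by
        rw [hr₁.pre_le.depSet_eq (hb hx)]
        exact hdep x (Finset.mem_union_right _ hx)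
    have hv₁' := hv₁.trans_right hr₂.pre_le
    refine ⟨t₂, v₁, v₂, (hr₁.trans hr₂).le (by rw [add_mul]), hr₂.preserves hs₁, ?_, ?_, ?_,
      hr₂.lines_subset hl₁, hl₂⟩
    · rintro rfl
      exact hv₂.notMem hv₁.mem_vars
    · simpa using ⟨hv₁'.mem_vars, hv₂.mem_vars⟩
    · simpa using ⟨depSet_newVar_subset hv₁', depSet_newVar_subset hv₂⟩
  induction hG generalizing s with
  | fls =>
    obtain ⟨t, v, h⟩ := exists_def_of (M := M) (G := fls) (D := D) hN hs hGs
      (extDep_subset_of (by simp))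
      (exists_extOr F M s ∅ ∅ (by simp) (by simp)) fun v => by
        rw [conjFormula_empty, clauseFormula_empty]
        exact Prov.rule1 [var v] (imp tru (iff (var 0) fls)) (iff (var 0) fls)
          (Prov.hyp (n := 0) (.inr rfl)) (by intro v; simp [Holds])
    exact ⟨t, v, h.1.le (by simp [nodes]), h.2⟩
  | tru =>
    obtain ⟨t, v, h⟩ := exists_def_of (M := M) (G := tru) (D := D) hN hs hGs
      (extDep_subset_of (by simp))
      (exists_extAnd F M s ∅ ∅ (by simp) (by simp)) fun v => by
        rw [conjFormula_empty]
        exact Prov.rule1 [var v] (imp tru (iff (var 0) tru)) (iff (var 0) tru)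
          (Prov.hyp (n := 0) (.inr rfl)) (by intro v; simp [Holds])
    exact ⟨t, v, h.1.le (by simp [nodes]), h.2⟩
  | var x =>
    simp only [vars, Finset.singleton_subset_iff, Finset.mem_singleton, forall_eq] at hGs hD
    obtain ⟨t, v, h⟩ := exists_def_of (M := M) (G := var x) (D := D) hN hs
      (by simpa [vars] using hGs) (extDep_subset_of (by simpa using hD))
      (exists_extAnd F M s ∅ {⟨x, true⟩} (by simp) (by simpa using hGs)) fun v => by
        rw [conjFormula_empty, conjFormula_singleton]
        exact Prov.rule1 [var v, var x] (imp tru (iff (var 0) (and (var 1) tru)))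
          (iff (var 0) (var 1)) (Prov.hyp (n := 0) (.inr rfl)) (by intro v; simp [Holds])
    exact ⟨t, v, h.1.le (by simp [nodes]), h.2⟩
  | @neg a _ ih =>
    obtain ⟨t, v₁, hr, hv, hl⟩ := ih hs hGs hD
    obtain ⟨t', v, hr', hv', hl'⟩ := exists_def_of (M := M) (G := neg a) hN (hr.preserves hs)
      (hGs.trans hr.pre_le.vars_subset) (D := D)
      (extDep_subset_of (by simpa using depSet_newVar_subset hv))
      (exists_extAnd F M t ∅ {⟨v₁, false⟩} (by simp) (by simpa using hv.mem_vars)) fun v => by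
        rw [conjFormula_empty, conjFormula_singleton]
        exact Prov.rule2 [var v, var v₁, a] (imp tru (iff (var 0) (and (neg (var 1)) tru)))
          (iff (var 1) (var 2)) (iff (var 0) (neg (var 2))) (Prov.hyp (n := 0) (.inr rfl))
          (Prov.hyp (n := 0) (.inl hl)) (by intro v; simp [Holds]; tauto)
    exact ⟨t', v, (hr.trans hr').le (by simp only [nodes]; ring_nf; rfl),
      hv'.trans_left hr.pre_le, hl'⟩
  | @and a b _ _ iha ihb =>
    obtain ⟨t, v₁, v₂, hr, ht, hne, hv, hdep, hl₁, hl₂⟩ := binary iha ihb hs hGs hD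
    obtain ⟨t', v, hr', hv', hl'⟩ := exists_def_of (M := M) (G := and a b) hN ht
      (hGs.trans hr.pre_le.vars_subset) (D := D)
      (extDep_subset_of hdep) (exists_extAnd F M t ∅ _ (by simp) hv) fun v => by
        rw [conjFormula_empty, conjFormula]
        rcases toList_pair (l := ⟨v₁, true⟩) (l' := ⟨v₂, true⟩) (by simpa using hne) with h | h
        · rw [h]
          exact Prov.rule3 [var v, var v₁, var v₂, a, b]
            (imp tru (iff (var 0) (and (var 1) (and (var 2) tru)))) (iff (var 1) (var 3))
            (iff (var 2) (var 4)) (iff (var 0) (and (var 3) (var 4)))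
            (Prov.hyp (n := 0) (.inr rfl)) (Prov.hyp (n := 0) (.inl hl₁))
            (Prov.hyp (n := 0) (.inl hl₂)) (by intro v; simp [Holds]; tauto)
        · rw [h]
          exact Prov.rule3 [var v, var v₁, var v₂, a, b]
            (imp tru (iff (var 0) (and (var 2) (and (var 1) tru)))) (iff (var 1) (var 3))
            (iff (var 2) (var 4)) (iff (var 0) (and (var 3) (var 4)))
            (Prov.hyp (n := 0) (.inr rfl)) (Prov.hyp (n := 0) (.inl hl₁))
            (Prov.hyp (n := 0) (.inl hl₂)) (by intro v; simp [Holds]; tauto)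
    exact ⟨t', v, (hr.trans hr').le (by simp only [nodes]; ring_nf; rfl),
      hv'.trans_left hr.pre_le, hl'⟩
  | @or a b _ _ iha ihb =>
    obtain ⟨t, v₁, v₂, hr, ht, hne, hv, hdep, hl₁, hl₂⟩ := binary iha ihb hs hGs hD
    obtain ⟨t', v, hr', hv', hl'⟩ := exists_def_of (M := M) (G := or a b) hN ht
      (hGs.trans hr.pre_le.vars_subset) (D := D)
      (extDep_subset_of hdep) (exists_extOr F M t ∅ _ (by simp) hv) fun v => by
        rw [conjFormula_empty, clauseFormula]
        rcases toList_pair (l := ⟨v₁, true⟩) (l' := ⟨v₂, true⟩) (by simpa using hne) with h | h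
        · rw [h]
          exact Prov.rule3 [var v, var v₁, var v₂, a, b]
            (imp tru (iff (var 0) (or (var 1) (or (var 2) fls)))) (iff (var 1) (var 3))
            (iff (var 2) (var 4)) (iff (var 0) (or (var 3) (var 4)))
            (Prov.hyp (n := 0) (.inr rfl)) (Prov.hyp (n := 0) (.inl hl₁))
            (Prov.hyp (n := 0) (.inl hl₂)) (by intro v; simp [Holds]; tauto)
        · rw [h]
          exact Prov.rule3 [var v, var v₁, var v₂, a, b]
            (imp tru (iff (var 0) (or (var 2) (or (var 1) fls)))) (iff (var 1) (var 3))
            (iff (var 2) (var 4)) (iff (var 0) (or (var 3) (var 4)))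
            (Prov.hyp (n := 0) (.inr rfl)) (Prov.hyp (n := 0) (.inl hl₁))
            (Prov.hyp (n := 0) (.inl hl₂)) (by intro v; simp [Holds]; tauto)
    exact ⟨t', v, (hr.trans hr').le (by simp only [nodes]; ring_nf; rfl),
      hv'.trans_left hr.pre_le, hl'⟩

end Reaches

/-! ### The matrix over the copies, weakened by the literal to be reduced -/

/-- A clause holds for the values of the variables `x ∈ S` under the literal `u.neg`, unless
`u` is true. -/
theorem Prov.or_subst_clauseFormula {Γ : Set Formula} {m : ℕ} {S : Finset ℕ} {f : ℕ → ℕ}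
    {u : Literal} {K : Clause} (hK : K.card ≤ m) (hΓ : clauseFormula K ∈ Γ)
    (h : ∀ x ∈ S, imp (conjFormula {u.neg}) (iff (var (f x)) (conjFormula {⟨x, true⟩})) ∈ Γ) :
    Prov Γ (3 * (m + 1) ^ 2) {or u.toFormula
      ((clauseFormula K).subst fun x => if x ∈ S then var (f x) else var x)} := by
  refine ((Prov.clauseFormula_imp (n := m + 1) fun l hl => ?_).mp
    (Prov.hyp (n := 0) hΓ)).le (m := 3 * (m + 1) ^ 2) ?_
  · have h1 := (Prov.imp_subst_clauseFormula (Γ := Γ)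
      (σ := fun x => if x ∈ S then var (f x) else var x) hl).le hK
    by_cases hlS : l.var ∈ S
    · have h2 := h _ hlS
      simp only [hlS, if_true, conjFormula_singleton] at h1 h2
      generalize (clauseFormula K).subst _ = A at h1 ⊢
      refine ((Prov.rule2 [var u.var, var l.var, var (f l.var), A]
        (imp (signed l.pos (var 2)) (var 3))
        (imp (and (signed (!u.pos) (var 0)) tru) (iff (var 2) (and (var 1) tru)))
        (imp (signed l.pos (var 1)) (or (signed u.pos (var 0)) (var 3)))
        (n := m) (m := 0) (h1.congr ?_) ((Prov.hyp h2).congr ?_) ?_ ?_)).congr ?_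
      · cases l.pos <;> rfl
      · rw [Literal.toFormula_eq_signed, Literal.neg]
        cases u.pos <;> rfl
      · intro v
        cases l.pos <;> cases u.pos <;> simp [Holds, signed] <;> tauto
      · cases l.pos <;> cases u.pos <;> decide
      · rw [Literal.toFormula_eq_signed, Literal.toFormula_eq_signed]
        cases l.pos <;> cases u.pos <;> rfl
    · simp only [hlS, if_false] at h1
      exact Prov.rule1 [l.toFormula, u.toFormula, _] (imp (var 0) (var 2))
        (imp (var 0) (or (var 1) (var 2))) h1 (by intro v; simp [Holds]; tauto)
  · calc _ ≤ m * (m + 1 + 1) + 1 + 0 + 1 := by gcongr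
      _ ≤ _ := by ring_nf; nlinarith [Nat.zero_le m]

theorem vars_conjClauses_subset {χ : Finset Clause} {O : Clause → Clause} {V : Finset ℕ}
    (h : ∀ D ∈ χ, ∀ k ∈ O D, k.var ∈ V) : (conjClauses χ O).vars ⊆ V :=
  vars_bigAnd_subset fun A hA => by
    obtain ⟨D, hD, rfl⟩ := List.mem_map.1 hA
    exact vars_clauseFormula_subset (h D (by simpa using hD))

theorem Formula.Basic.conjClauses (χ : Finset Clause) (O : Clause → Clause) :
    Basic (conjClauses χ O) :=
  .bigAnd fun A hA => by
    obtain ⟨D, -, rfl⟩ := List.mem_map.1 hA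
    exact .clauseFormula _

theorem nodes_conjClauses_le {χ : Finset Clause} {O : Clause → Clause} {m : ℕ}
    (hχ : χ.card ≤ m) (hO : ∀ D ∈ χ, (O D).card ≤ m) :
    (conjClauses χ O).nodes ≤ m * (3 * m + 2) + 1 := by
  have := nodes_bigAnd_le (l := χ.toList.map fun D => clauseFormula (O D)) (k := 3 * m + 1)
    fun A hA => by
      obtain ⟨D, hD, rfl⟩ := List.mem_map.1 hA
      have := hO D (by simpa using hD)
      exact (nodes_clauseFormula_le _).trans (by omega)
  rw [List.length_map, Finset.length_toList] at this
  exact this.trans (by gcongr)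

/-! ### Dependencies of outer clauses and size bounds -/

namespace DepPrefix

variable {P : DepPrefix} {u : ℕ} {D : Clause} {k : Literal}

theorem outerClause_subset (P : DepPrefix) (u : ℕ) (D : Clause) : P.outerClause u D ⊆ D :=
  Finset.filter_subset _ _

theorem mem_vars_of_mem_outerClause (hk : k ∈ P.outerClause u D) : k.var ∈ P.vars := by
  rcases (Finset.mem_filter.1 hk).2 with h | h
  · exact Finset.mem_union_right _ h.1
  · exact Finset.mem_union_left _ h.1

theorem depSet_subset_of_mem_outerClause (hk : k ∈ P.outerClause u D) :
    P.depSet k.var ⊆ P.commonDeps u := by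
  unfold depSet
  rcases (Finset.mem_filter.1 hk).2 with h | h
  · rw [if_pos h.1]
    exact h.2
  · rw [if_neg (Finset.disjoint_left.1 P.disjoint h.1)]
    simpa using h.2

theorem notMem_commonDeps (P : DepPrefix) (u : ℕ) : u ∉ P.commonDeps u := fun h =>
  (Finset.mem_filter.1 h).2.1 rfl

/-- A variable of `𝒮` depends on `u`, whereas `T` excludes `u`. Hence copying leaves outer clauses
unchanged. -/
theorem notMem_dependents_of_mem_outerClause (hk : k ∈ P.outerClause u D) :
    k.var ∉ P.dependents u := by
  intro h
  obtain ⟨h1, h2⟩ := Finset.mem_filter.1 h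
  have := depSet_subset_of_mem_outerClause hk
  rw [depSet, if_pos h1] at this
  exact P.notMem_commonDeps u (this h2)

theorem ne_of_mem_outerClause (hu : u ∈ P.univ) (hk : k ∈ P.outerClause u D) : k.var ≠ u := by
  intro h
  have := depSet_subset_of_mem_outerClause hk
  rw [depSet, h, if_neg (Finset.disjoint_left.1 P.disjoint hu)] at this
  exact P.notMem_commonDeps u (this (by simp))

/-- This is why the outer clauses may enter the definition of every new variable without enlarging
its dependency set. -/
theorem commonDeps_subset {x : ℕ} (hx : x ∈ P.dependents u) : P.commonDeps u ⊆ P.dep x :=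
  fun _ hw => (Finset.mem_filter.1 hw).2.2 x hx

end DepPrefix

theorem DQBF.card_matrix_le (Q : DQBF) : Q.matrix.card ≤ Q.size := by
  have : Q.matrix.card ≤ ∑ K ∈ Q.matrix, (1 + K.card) := by
    rw [Finset.card_eq_sum_ones]
    exact Finset.sum_le_sum fun _ _ => by omega
  unfold DQBF.size
  omega

theorem DQBF.card_clause_le (Q : DQBF) {K : Clause} (hK : K ∈ Q.matrix) : K.card ≤ Q.size := by
  have : 1 + K.card ≤ ∑ K ∈ Q.matrix, (1 + K.card) :=
    Finset.single_le_sum (f := fun K : Clause => 1 + K.card) (fun _ _ => Nat.zero_le _) hK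
  unfold DQBF.size
  omega

theorem DQBF.card_dependents_le (Q : DQBF) (u : ℕ) : (Q.pre.dependents u).card ≤ Q.size := by
  have h1 : (Q.pre.dependents u).card ≤ Q.pre.exis.card :=
    Finset.card_le_card (Finset.filter_subset _ _)
  have h2 : Q.pre.exis.card ≤ ∑ x ∈ Q.pre.exis, (1 + (Q.pre.dep x).card) := by
    rw [Finset.card_eq_sum_ones]
    exact Finset.sum_le_sum fun _ _ => by omega
  unfold DQBF.size
  omega

/-! ### Deriving the restricted matrix and all lines of the setup -/

/-- The substitution of the new variables `f x` for the `x ∈ S` and of the truth value that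
falsifies the literal `u` for its variable. -/
def restrictSubst (S : Finset ℕ) (f : ℕ → ℕ) (u : Literal) (x : ℕ) : Formula :=
  if x = u.var then ofBool (!u.pos) else if x ∈ S then var (f x) else var x

/-- Derivation of the restriction of the matrix to the falsified literal `u`, over new variables
`f x` that depend on at most the variables on which `x` depends, except `u`. -/
theorem Reaches.exists_restriction {F : FregeSystem} {N : ℕ} (hN : Simulates F N) (Q : DQBF)
    (u : Literal) (hu : u.var ∈ Q.pre.univ) :
    ∃ (s : Stage) (f : ℕ → ℕ),
      Reaches F {L | ∃ K ∈ Q.matrix, L = clauseFormula K}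
        (Q.size + Q.size + Q.size * (N * (3 * (Q.size + 1) ^ 2) + 1 + N)) ⟨Q.pre, []⟩ s ∧
      (∀ x ∈ Q.pre.dependents u.var,
        Q.pre.NewVar s.pre (f x) ((Q.pre.dep x).erase u.var)) ∧
      (∀ K ∈ Q.matrix, clauseFormula K ∈ s.lines) ∧
      ∀ K ∈ Q.matrix, (clauseFormula K).subst
        (restrictSubst (Q.pre.dependents u.var) f u) ∈ s.lines := by
  set S := Q.pre.dependents u.var with hS
  have hm := Q.card_matrix_le
  have hKvars : ∀ K ∈ Q.matrix, (clauseFormula K).vars ⊆ Q.pre.vars := fun K hK =>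
    vars_clauseFormula_subset (Q.closed K hK)
  obtain ⟨Γ₁, hr₁, hm₁⟩ := family (F := F) (M := {L | ∃ K ∈ Q.matrix, L = clauseFormula K})
    (n := 1) Q.matrix clauseFormula ⟨Q.pre, []⟩ (fun K hK Γ _ _ => ⟨_, of_step
      (.ax Q.pre Γ _ ⟨K, hK, rfl⟩) (.refl _) (hKvars K hK), List.mem_cons_self⟩)
    (fun L hL => absurd hL List.not_mem_nil)
  have hs₁ := hr₁.preserves fun L hL => absurd hL List.not_mem_nil
  -- Taking `α = {ū}` is the essential use of independent extension: it removes `var(u)` from the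
  -- dependency set of each copy.
  obtain ⟨s₂, f, hr₂, -, hf⟩ := exists_newVars (F := F)
    (M := {L | ∃ K ∈ Q.matrix, L = clauseFormula K}) S (n := 1)
    (fun x => (Q.pre.dep x).erase u.var)
    (fun x v => imp (conjFormula {u.neg}) (iff (var v) (conjFormula {⟨x, true⟩}))) ⟨Q.pre, Γ₁⟩
    (fun x hx t ht hle _ => by
      have hx' := (Finset.mem_filter.1 hx).1
      obtain ⟨t', v, hr, hv, hl⟩ := exists_extAnd F
        {L | ∃ K ∈ Q.matrix, L = clauseFormula K} t {u.neg} {⟨x, true⟩}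
        (by simpa [Literal.neg, hle.univ_eq] using hu)
        (by simpa using hle.vars_subset (Finset.mem_union_right _ hx'))
      refine ⟨t', v, hr, ⟨hv.1, hv.2, hv.3.trans ?_⟩, hl⟩
      have hd : t.pre.depSet x = Q.pre.dep x := by
        rw [hle.depSet_eq (Finset.mem_union_right _ hx'), DepPrefix.depSet, if_pos hx']
      rw [DepPrefix.extDep]
      simp [hd, Literal.neg, Finset.sdiff_singleton_eq_erase]) hs₁
  have hs₂ := hr₂.preserves hs₁
  have hle₂ := hr₂.pre_le
  have hu₂ : u.var ∈ s₂.pre.univ := by rw [hle₂.univ_eq]; exact hu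
  have hfu : ∀ x ∈ S, f x ≠ u.var := fun x hx h =>
    (hf x hx).1.notMem (h ▸ Finset.mem_union_left _ hu)
  have hσ : ∀ x, ((if x ∈ S then var (f x) else var x).subst
      (Function.update var u.var (ofBool !u.pos))) = restrictSubst S f u x := by
    intro x
    have huS : u.var ∉ S := fun h =>
      Finset.disjoint_left.1 Q.pre.disjoint hu (Finset.mem_filter.1 h).1
    unfold restrictSubst
    by_cases hxu : x = u.var
    · subst hxu
      simp [huS, subst]
    · by_cases hxS : x ∈ S
      · simp [hxu, hxS, subst, hfu x hxS]
      · simp [hxu, hxS, subst]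
  -- The side condition of reduction: variables outside `𝒮` do not depend on `var(u)`, and those in
  -- `𝒮` have been replaced by copies that do not either.
  have hsub : ∀ K ∈ Q.matrix, ((clauseFormula K).subst
      fun x => if x ∈ S then var (f x) else var x).vars ⊆
      {x ∈ s₂.pre.vars | x ∈ s₂.pre.exis → u.var ∉ s₂.pre.dep x} := by
    refine fun K hK => vars_subst_subset fun x hx => ?_
    have hxQ := hKvars K hK hx
    by_cases hxS : x ∈ S
    · rw [if_pos hxS]
      have h := (hf x hxS).1
      simpa [vars] using And.intro h.mem_vars
        fun _ h' => Finset.notMem_erase _ _ (h.dep_subset h')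
    · rw [if_neg hxS]
      simp only [vars, Finset.singleton_subset_iff, Finset.mem_filter]
      refine ⟨hle₂.vars_subset hxQ, fun hx₂ hd => hxS ?_⟩
      have hxe : x ∈ Q.pre.exis := by
        rcases Finset.mem_union.1 hxQ with h | h
        · exact absurd hx₂ (Finset.disjoint_left.1 s₂.pre.disjoint (by rwa [hle₂.univ_eq]))
        · exact h
      rw [hle₂.dep_eq x hxe] at hd
      exact Finset.mem_filter.2 ⟨hxe, hd⟩
  obtain ⟨Γ₃, hr₃, hm₃⟩ := family (F := F) (M := {L | ∃ K ∈ Q.matrix, L = clauseFormula K})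
    (n := N * (3 * (Q.size + 1) ^ 2) + 1 + N) Q.matrix
    (fun K => (clauseFormula K).subst (restrictSubst S f u)) s₂ (fun K hK Γ hΓ hsc => by
      have h1 := Prov.or_subst_clauseFormula (Γ := {L | L ∈ Γ}) (S := S) (f := f) (u := u)
        (Q.card_clause_le hK) (hΓ (hr₂.lines_subset (hm₁ K hK)))
        fun x hx => hΓ (hf x hx).2
      have hv : (or u.toFormula ((clauseFormula K).subst
          fun x => if x ∈ S then var (f x) else var x)).vars ⊆
          {x ∈ s₂.pre.vars | x ∈ s₂.pre.exis → u.var ∉ s₂.pre.dep x} := by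
        refine Finset.union_subset ?_ (hsub K hK)
        rw [vars_toFormula, Finset.singleton_subset_iff, Finset.mem_filter]
        exact ⟨Finset.mem_union_left _ hu₂,
          fun h => absurd h (Finset.disjoint_left.1 s₂.pre.disjoint hu₂)⟩
      obtain ⟨Γ', hr', hm'⟩ := hN.prov {L | ∃ K ∈ Q.matrix, L = clauseFormula K} hsc h1
        (by simpa only [Set.mem_singleton_iff, forall_eq] using
          hv.trans (Finset.filter_subset _ _))
      have hr'' := of_red (F := F) (M := {L | ∃ K ∈ Q.matrix, L = clauseFormula K})
        (s := ⟨s₂.pre, Γ'⟩) _ u.var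
        (!u.pos) (hm' _ rfl) hu₂
        (fun x hx hxe => (Finset.mem_filter.1 (hv hx)).2 hxe) (hr'.preserves hsc)
      have hrep : (or u.toFormula ((clauseFormula K).subst
          fun x => if x ∈ S then var (f x) else var x)).replace u.var (ofBool !u.pos) =
          or (signed u.pos (ofBool !u.pos)) ((clauseFormula K).subst (restrictSubst S f u)) := by
        simp only [replace, subst, subst_subst, hσ, Literal.subst_toFormula,
          Function.update_self]
      rw [hrep] at hr''
      have hscv := hr''.preserves (hr'.preserves hsc) _ List.mem_cons_self
      -- After reduction the first disjunct is a false constant or a negated true one; one inference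
      -- removes it.
      obtain ⟨Γ'', hr₃, hm₃⟩ := hN.prov {L | ∃ K ∈ Q.matrix, L = clauseFormula K}
        (hr''.preserves (hr'.preserves hsc)) (n := 1)
        (Δ := {(clauseFormula K).subst (restrictSubst S f u)})
        (Prov.rule1 [(clauseFormula K).subst (restrictSubst S f u)]
          (or (signed u.pos (ofBool !u.pos)) (var 0)) (var 0)
          ((Prov.hyp (n := 0) (List.mem_cons_self)).congr (by cases u.pos <;> rfl))
          (by intro v; cases u.pos <;> simp [Holds, signed, ofBool])
          (by cases u.pos <;> decide))
        (by simpa only [Set.mem_singleton_iff, forall_eq] using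
          Finset.union_subset_right hscv)
      exact ⟨Γ'', ((hr'.trans hr'').trans hr₃).le (by omega), hm₃ _ rfl⟩) hs₂
  refine ⟨_, f, ((hr₁.trans hr₂).trans hr₃).le ?_, fun x hx => (hf x hx).1,
    fun K hK => hr₃.lines_subset (hr₂.lines_subset (hm₁ K hK)), hm₃⟩
  have := Q.card_dependents_le u.var
  rw [mul_one, mul_one]
  gcongr

/-- The lines needed for the copy of the matrix are reached in a polynomial number of steps. -/
theorem exists_copySetup {F : FregeSystem} {N : ℕ} (hN : Simulates F N) (Q : DQBF) (φ : CNF)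
    (C : Clause) (u : Literal) (hu : u.var ∈ Q.pre.univ)
    (hQ : Q.matrix = insert (insert u C) φ)
    (hup : ∀ D : Clause, PathClause Q.matrix {insert u C} (Q.pre.dependents u.var) D →
      u.neg ∈ D →
      UnitRefutes (φ ∪ negClause C ∪ negClause (Q.pre.outerClause u.var D))) :
    ∃ (s : Stage) (χ : Finset Clause) (σ₀ : ℕ → Formula) (ρ : ℕ → ℕ) (p q : ℕ → Bool),
      Reaches F {L | ∃ K ∈ Q.matrix, L = clauseFormula K}
        (Q.size + Q.size + Q.size * (N * (3 * (Q.size + 1) ^ 2) + 1 + N) +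
          Q.size * (N * (20 * (Q.size + 1) ^ 3)) +
          Q.size * ((2 * (Q.size * (3 * Q.size + 2) + 4) + 13) * (N + 1))) ⟨Q.pre, []⟩ s ∧
      (∀ x ∈ Q.pre.dependents u.var, Q.pre.NewVar s.pre (ρ x) (Q.pre.dep x)) ∧
      Set.InjOn ρ (Q.pre.dependents u.var) ∧
      CopySetup {L | L ∈ s.lines} Q.size φ C u (Q.pre.dependents u.var) χ
        (Q.pre.outerClause u.var) σ₀ ρ p q := by
  classical
  set S := Q.pre.dependents u.var with hS
  set m := Q.size with hm
  have hm₁ : Q.matrix.card ≤ m := Q.card_matrix_le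
  have hm₂ : ∀ K ∈ Q.matrix, K.card ≤ m := fun K hK => Q.card_clause_le hK
  have huS : u.var ∉ S := fun h =>
    Finset.disjoint_left.1 Q.pre.disjoint hu (Finset.mem_filter.1 h).1
  have hSe : ∀ x ∈ S, x ∈ Q.pre.exis := fun x hx => (Finset.mem_filter.1 hx).1
  have hSu : ∀ x ∈ S, x ≠ u.var := fun x hx h => huS (h ▸ hx)
  have hmC : insert u C ∈ Q.matrix := hQ ▸ Finset.mem_insert_self _ _
  have hφ : φ ⊆ Q.matrix := hQ ▸ Finset.subset_insert _ _
  have hC : C.card ≤ m := (Finset.card_le_card (Finset.subset_insert u C)).trans (hm₂ _ hmC)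
  have hCv : ∀ l ∈ C, l.var ∈ Q.pre.vars := fun l hl =>
    Q.closed _ hmC l (Finset.mem_insert_of_mem hl)
  set χ : Finset Clause := {D ∈ Q.matrix | PathClause Q.matrix {insert u C} S D ∧ u.neg ∈ D}
    with hχ
  set O := Q.pre.outerClause u.var with hO
  have hχm : χ.card ≤ m := (Finset.card_le_card (Finset.filter_subset _ _)).trans hm₁
  have hOm : ∀ D ∈ χ, (O D).card ≤ m := fun D hD =>
    (Finset.card_le_card (DepPrefix.outerClause_subset _ _ _)).trans
      (hm₂ D (Finset.mem_filter.1 hD).1)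
  obtain ⟨s₁, f, hr₁, hf, hl₁, hl₁'⟩ := Reaches.exists_restriction hN Q u hu
  have hs₁ := hr₁.preserves fun L hL => absurd hL List.not_mem_nil
  have hle₁ := hr₁.pre_le
  obtain ⟨Γ₂, hr₂, hl₂⟩ := Reaches.family (F := F)
    (M := {L | ∃ K ∈ Q.matrix, L = clauseFormula K}) (n := N * (20 * (m + 1) ^ 3)) χ
    (fun D => or (clauseFormula C) (clauseFormula (O D))) s₁ (fun D hD Γ hΓ hsc => by
      obtain ⟨hD1, hD2, hD3⟩ := Finset.mem_filter.1 hD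
      obtain ⟨Γ', hr', hm'⟩ := hN.prov {L | ∃ K ∈ Q.matrix, L = clauseFormula K} hsc
        (Prov.or_of_unitRefutes (fun K hK => hΓ (hl₁ K (hφ hK))) (fun K hK => hm₂ K (hφ hK))
          ((Finset.card_le_card hφ).trans hm₁) hC (hOm D hD) (hup D hD2 hD3)) (by
        rintro _ rfl
        exact (Finset.union_subset (vars_clauseFormula_subset hCv) (vars_clauseFormula_subset
          fun k hk => DepPrefix.mem_vars_of_mem_outerClause hk)).trans hle₁.vars_subset)
      exact ⟨Γ', hr', hm' _ rfl⟩) hs₁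
  have hs₂ := hr₂.preserves hs₁
  -- The path information enters the definitions as fixed constants; the derivation need not compute
  -- it.
  have hc : ∃ p q : ℕ → Bool, ∀ x,
      (p x = true ↔ PathLit Q.matrix {insert u C} S ⟨x, true⟩) ∧
      (q x = true ↔ PathLit Q.matrix {insert u C} S ⟨x, false⟩) :=
    ⟨fun x => decide (PathLit Q.matrix {insert u C} S ⟨x, true⟩),
      fun x => decide (PathLit Q.matrix {insert u C} S ⟨x, false⟩), fun x => by simp⟩
  obtain ⟨p, q, hpq⟩ := hc
  have hσ : ∀ x ∈ S, restrictSubst S f u x = var (f x) := fun x hx => by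
    simp [restrictSubst, hSu x hx, hx]
  obtain ⟨s₃, g, hr₃, hg, hl₃⟩ := Reaches.exists_newVars (F := F)
    (M := {L | ∃ K ∈ Q.matrix, L = clauseFormula K}) S
    (n := (2 * (m * (3 * m + 2) + 4) + 13) * (N + 1)) Q.pre.dep
    (fun x v => iff (var v) (switch (and (conjClauses χ O) u.toFormula) (var x)
      (restrictSubst S f u x) (p x) (q x))) ⟨s₁.pre, Γ₂⟩ (fun x hx t ht hle hsub => by
      have hle' : Q.pre.Le t.pre := hle₁.trans hle
      -- Everything in the definition of `x'` depends only on `D_x`: outer clauses through `T`, `u`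
      -- because `x ∈ 𝒮`, `x` itself, and its copy through `D_x` without `var(u)`.
      have hG : ∀ y ∈ (switch (and (conjClauses χ O) u.toFormula) (var x)
          (restrictSubst S f u x) (p x) (q x)).vars,
          y ∈ {y ∈ t.pre.vars | t.pre.depSet y ⊆ Q.pre.dep x} := by
        intro y hy
        rw [hσ x hx, vars_switch] at hy
        simp only [vars, vars_toFormula, Finset.mem_union, Finset.mem_singleton, or_assoc] at hy
        rw [Finset.mem_filter]
        have old : ∀ {y}, y ∈ Q.pre.vars → Q.pre.depSet y ⊆ Q.pre.dep x →
            y ∈ t.pre.vars ∧ t.pre.depSet y ⊆ Q.pre.dep x := fun h1 h2 =>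
          ⟨hle'.vars_subset h1, by rwa [hle'.depSet_eq h1]⟩
        rcases hy with hy | rfl | rfl | rfl
        · have := vars_conjClauses_subset (χ := χ) (O := O)
            (V := {y ∈ Q.pre.vars | Q.pre.depSet y ⊆ Q.pre.dep x}) (fun D hD k hk =>
              Finset.mem_filter.2 ⟨DepPrefix.mem_vars_of_mem_outerClause hk,
                (DepPrefix.depSet_subset_of_mem_outerClause hk).trans
                  (DepPrefix.commonDeps_subset hx)⟩) hy
          exact old (Finset.mem_filter.1 this).1 (Finset.mem_filter.1 this).2
        · refine old (Finset.mem_union_left _ hu) ?_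
          rw [DepPrefix.depSet, if_neg (Finset.disjoint_left.1 Q.pre.disjoint hu)]
          simpa using (Finset.mem_filter.1 hx).2
        · refine old (Finset.mem_union_right _ (hSe _ hx)) ?_
          rw [DepPrefix.depSet, if_pos (hSe _ hx)]
        · have hv := (hf x hx).trans_right hle
          exact ⟨hv.mem_vars,
            (Reaches.depSet_newVar_subset hv).trans (Finset.erase_subset _ _)⟩
      obtain ⟨t', v, hr, hv, hl⟩ := Reaches.exists_def
        (M := {L | ∃ K ∈ Q.matrix, L = clauseFormula K}) (D := Q.pre.dep x) hN
        (.switch (.and (.conjClauses χ O) (.toFormula u)) (.var x)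
          (by rw [hσ x hx]; exact .var _) (p x) (q x)) ht
        (fun y hy => (Finset.mem_filter.1 (hG y hy)).1)
        (fun y hy => (Finset.mem_filter.1 (hG y hy)).2)
      refine ⟨t', v, hr.le (Nat.mul_le_mul_right _ ?_), hv, hl⟩
      rw [nodes_switch, hσ x hx]
      have h1 := nodes_conjClauses_le hχm hOm
      have h2 := nodes_toFormula_le u
      simp only [nodes]
      omega) hs₂
  refine ⟨s₃, χ, restrictSubst S f u, fun x => if x ∈ S then g x else x, p, q,
    ((hr₁.trans hr₂).trans hr₃).le ?_, fun x hx => ?_, fun x hx y hy hxy => ?_, ?_⟩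
  · have := Q.card_dependents_le u.var
    gcongr
  · simp only [hx, if_true]
    exact (hl₃ x hx).1.trans_left hle₁
  · simp only [Finset.mem_coe] at hx hy
    simp only [hx, hy, if_true] at hxy
    exact hg hx hy hxy
  · have h12 : ∀ {L}, L ∈ s₁.lines → L ∈ s₃.lines := fun h =>
      hr₃.lines_subset (hr₂.lines_subset h)
    exact
    { var_notMem := huS
      card_chi := hχm
      card_clause := hQ ▸ hm₂
      mem_chi := fun D => by rw [hχ, Finset.mem_filter, hQ]
      outer := fun D hD k hk => ⟨DepPrefix.outerClause_subset _ _ _ hk,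
        DepPrefix.notMem_dependents_of_mem_outerClause hk,
        DepPrefix.ne_of_mem_outerClause hu hk⟩
      path_true := fun x _ => hQ ▸ (hpq x).1
      path_false := fun x _ => hQ ▸ (hpq x).2
      rho_of_notMem := fun x hx => if_neg hx
      sigma_of_notMem := fun x hx hxu => by simp [restrictSubst, hx, hxu]
      sigma_var := by simp [restrictSubst]
      mem_matrix := fun K hK => h12 (hl₁ K (hQ ▸ hK))
      mem_restricted := fun K hK => h12 (hl₁' K (hQ ▸ hK))
      mem_outer := fun D hD => hr₃.lines_subset (hl₂ D hD)
      mem_def := fun x hx => by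
        rw [if_pos hx]
        exact (hl₃ x hx).2 }

end DFrege

/-! ### Assembly and the polynomial bound -/

theorem mainTheorem7 (F : DFrege.FregeSystem) :
    ∃ p : Polynomial ℕ,
      ∀ (Q : DFrege.DQBF) (φ : DFrege.CNF) (C : DFrege.Clause) (u : DFrege.Literal),
        u.var ∈ Q.pre.univ →
        Q.matrix = insert (insert u C) φ →
        (∀ D : DFrege.Clause,
          DFrege.PathClause Q.matrix {insert u C} (Q.pre.dependents u.var) D → u.neg ∈ D →
          DFrege.UnitRefutes
            (φ ∪ DFrege.negClause C ∪ DFrege.negClause (Q.pre.outerClause u.var D))) →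
        ∃ (n : ℕ) (s : DFrege.Stage) (ρ : ℕ → ℕ),
          n ≤ p.eval Q.size ∧
          DFrege.Derives F Q n s ∧
          s.pre.univ = Q.pre.univ ∧
          Q.pre.exis ⊆ s.pre.exis ∧
          (∀ x ∈ Q.pre.exis, s.pre.dep x = Q.pre.dep x) ∧
          (∀ x ∈ Q.pre.dependents u.var,
            ρ x ∈ s.pre.exis ∧ ρ x ∉ Q.pre.vars ∧ s.pre.dep (ρ x) ⊆ Q.pre.dep x) ∧
          Set.InjOn ρ (Q.pre.dependents u.var) ∧
          (∀ x ∉ Q.pre.dependents u.var, ρ x = x) ∧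
          ∀ K ∈ insert C φ,
            DFrege.clauseFormula (DFrege.renameClause ρ K) ∈ s.lines := by
  obtain ⟨N, hN⟩ := DFrege.exists_simulates F
  -- The summands pay for the axioms, the copies `x₀`, the restricted clauses, the clauses `C ∨
  -- O_D`, the definitions of `x'`, and the final clauses. Only `N` depends on the Frege system.
  refine ⟨Polynomial.X + Polynomial.X + Polynomial.X *
    (Polynomial.C N * (3 * (Polynomial.X + 1) ^ 2) + 1 + Polynomial.C N) +
    Polynomial.X * (Polynomial.C N * (20 * (Polynomial.X + 1) ^ 3)) +
    Polynomial.X * ((2 * (Polynomial.X * (3 * Polynomial.X + 2) + 4) + 13) *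
      (Polynomial.C N + 1)) +
    (Polynomial.X + 1) * (Polynomial.C N * (13 * (Polynomial.X + 1) ^ 3)), ?_⟩
  intro Q φ C u hu hQ hup
  obtain ⟨s, χ, σ₀, ρ, p, q, hr, hρ, hinj, hcs⟩ :=
    DFrege.exists_copySetup hN Q φ C u hu hQ hup
  have hs := hr.preserves fun L hL => absurd hL List.not_mem_nil
  have hvars : ∀ K ∈ insert C φ, ∀ l ∈ K, l.var ∈ Q.pre.vars := by
    intro K hK l hl
    rcases Finset.mem_insert.1 hK with rfl | hK
    · exact Q.closed (insert u K) (by simp [hQ]) l (Finset.mem_insert_of_mem hl)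
    · exact Q.closed K (by simp [hQ, hK]) l hl
  obtain ⟨Γ, hr', hl'⟩ := DFrege.Reaches.family (F := F)
    (M := {L | ∃ K ∈ Q.matrix, L = DFrege.clauseFormula K})
    (n := N * (13 * (Q.size + 1) ^ 3)) (insert C φ)
    (fun K => DFrege.clauseFormula (DFrege.renameClause ρ K)) s (fun K hK Γ hΓ hsc => by
      obtain ⟨Γ', hr', hm'⟩ := hN.prov {L | ∃ K ∈ Q.matrix, L = DFrege.clauseFormula K} hsc
        ((hcs.rename hK).mono hΓ) (by
        rintro _ rfl
        refine DFrege.vars_clauseFormula_subset fun l hl => ?_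
        obtain ⟨k, hk, rfl⟩ := Finset.mem_image.1 hl
        by_cases hkS : k.var ∈ Q.pre.dependents u.var
        · exact (hρ _ hkS).mem_vars
        · simpa [hcs.rho_of_notMem _ hkS] using hr.pre_le.vars_subset (hvars K hK k hk))
      exact ⟨Γ', hr', hm' _ rfl⟩) hs
  -- The extra `1` accounts for `C`, which need not be a clause of the matrix.
  have hcard : (insert C φ).card ≤ Q.size + 1 := by
    have h1 : φ.card ≤ Q.matrix.card := Finset.card_le_card (by simp [hQ])
    have h2 := Q.card_matrix_le
    have h3 := Finset.card_insert_le C φ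
    omega
  obtain ⟨k, hk, hc⟩ := (hr.trans hr').chain
  refine ⟨k, _, ρ, ?_, hc.derives, hr.pre_le.univ_eq, hr.pre_le.exis_subset,
    hr.pre_le.dep_eq, fun x hx => ⟨(hρ x hx).mem, (hρ x hx).notMem, (hρ x hx).dep_subset⟩,
    hinj, hcs.rho_of_notMem, hl'⟩
  refine hk.trans ?_
  simp only [Polynomial.eval_add, Polynomial.eval_mul, Polynomial.eval_pow, Polynomial.eval_X,
    Polynomial.eval_C, Polynomial.eval_one, Polynomial.eval_ofNat]
  gcongr
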